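/- Let $n\ge 3$ and consider a periodic chain (ring) of $n$ spins $1$, with sites labelled modulo $n$ and the Hamiltonian $$H=\sum_{k=1}^n h_k,\qquad h_k=\vec S_k\cdot\vec S_{k+1}+\tfrac13(\vec S_k\cdot\vec S_{k+1})^2 .$$ (a) As an operator on two spins, $h_k$ has the eigenvalues $4/3$ ($5$-fold degenerate, the eigenspace being the subspace of total spin $2$) and $-2/3$ ($4$-fold degenerate), and $P_k=\frac12(\frac23\mathbf 1+h_k)$ is the orthogonal projector onto the eigenspace of $4/3$. (b) $H$ has a normalised ground state $|\Psi\rangle$ (the AKLT state), unique up to a phase, and the vectors $|\varphi\rangle$ with $h_k|\varphi\rangle=-\frac23|\varphi\rangle$ for all $k$ are exactly the multiples of $|\Psi\rangle$. (c) There are finite families $(U^\alpha)_{\alpha=1}^N$ of unitaries on $\mathbb C^3\otimes\mathbb C^3$ that twirl, i.e. $\frac1N\sum_\alpha (U^\alpha)^\dagger\rho\,U^\alpha=\frac19\mathrm{tr}(\rho)\mathbf 1$ for all $\rho$. For every $k$ let $(U_k^\alpha)_{\alpha=1}^N$ be any such family, acting on the sites $k,k+1$, and put $c_k^\alpha=U_k^\alpha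 P_k$. Then: 1. each $c_k^\alpha$ acts nontrivially only on the sites $k,k+1$; 2. $c_k^\alpha|\varphi\rangle=0$ for all $k,\alpha$ if and only if $|\varphi\rangle$ is a multiple of $|\Psi\rangle$ (so $|\Psi\rangle$ is the unique dark state); 3. for the completely positive maps $\mathcal E_k(X)=\sum_\alpha (c_k^\alpha)^\dagger X c_k^\alpha$ and every $k$, going once around the ring gives $\mathcal E_{k}\circ\mathcal E_{k-1}\circ\cdots\circ\mathcal E_{k+1}(|\Psi\rangle\langle\Psi|)=C\,P_k$ with some $C>0$ (where $P_k$ is tensored with the identity on the other sites); 4. for all rates $g_{k,\alpha}>0$, $|\Psi\rangle\langle\Psi|$ is the unique stationary state, pure or mixed, of the master equation $\dot\rho=\sum_{k,\alpha}g_{k,\alpha}\bigl(2c_k^\alpha\rho (c_k^\alpha)^\dagger-(c_k^\alpha)^\dagger c_k^\alpha\rho-\rho (c_k^\alpha)^\dagger c_k^\alpha\bigr)$; that is, a density matrix $\rho$ makes the right-hand side vanish if and only if $\rho=|\Psi\rangle\langle\Psi|$. (d) Let $|\Phi_1\rangle,\dots,|\Phi_5\rangle$ and $|\Psi_1\rangle,\dots,|\Psi_4\rangle$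 be orthonormal bases of the two-spin eigenspaces of $4/3$ and $-2/3$, and let $c_k=\sum_{i=1}^4|\Psi_i\rangle\langle\Phi_i|+|\Phi_4\rangle\langle\Phi_5|$, acting on the sites $k,k+1$. Then $c_k=U_kP_k$ for some unitary $U_k$ on two spins; the two-spin eigenvectors of $c_k$ are exactly the nonzero vectors of $\mathrm{span}\{|\Psi_i\rangle\}$; and for all rates $g_k>0$ the only pure stationary state of $\dot\rho=\sum_k g_k(2c_k\rho c_k^\dagger-c_k^\dagger c_k\rho-\rho c_k^\dagger c_k)$ is $|\Psi\rangle\langle\Psi|$. -/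

import Mathlib

open scoped Matrix Kronecker ComplexOrder

noncomputable section

namespace AKLT

/-- Operators on the pair of spins of one bond, `ℂ³ ⊗ ℂ³`. -/
abbrev BondOp := Matrix (Fin 3 × Fin 3) (Fin 3 × Fin 3) ℂ

/-- Vectors of the chain of `n` spins, `(ℂ³)^{⊗ n}`, in the product basis of `S^z` eigenvectors. -/
abbrev ChainVec (n : ℕ) := (Fin n → Fin 3) → ℂ

/-- Operators on the chain of `n` spins. -/
abbrev ChainOp (n : ℕ) := Matrix (Fin n → Fin 3) (Fin n → Fin 3) ℂ

/-! Spin-1 matrices. -/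

def Sx : Matrix (Fin 3) (Fin 3) ℂ :=
  ((1 / Real.sqrt 2 : ℝ) : ℂ) • !![0, 1, 0; 1, 0, 1; 0, 1, 0]

def Sy : Matrix (Fin 3) (Fin 3) ℂ :=
  ((1 / Real.sqrt 2 : ℝ) : ℂ) •
    !![0, -Complex.I, 0; Complex.I, 0, -Complex.I; 0, Complex.I, 0]

def Sz : Matrix (Fin 3) (Fin 3) ℂ := !![1, 0, 0; 0, 0, 0; 0, 0, -1]

/-- The Heisenberg coupling `S · S'` of two spins. -/
def spinDot : BondOp := Sx ⊗ₖ Sx + Sy ⊗ₖ Sy + Sz ⊗ₖ Sz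

/-- The component of the total spin of the two sites of a bond given by the one-site matrix `S`. -/
def totalComp (S : Matrix (Fin 3) (Fin 3) ℂ) : BondOp := S ⊗ₖ 1 + 1 ⊗ₖ S

/-- The square of the total spin of the two sites of a bond (`j (j + 1)` on the spin-`j` part). -/
def totalSpinSq : BondOp := totalComp Sx ^ 2 + totalComp Sy ^ 2 + totalComp Sz ^ 2

/-- The AKLT interaction of one bond. -/
def bondH : BondOp := spinDot + (1 / 3 : ℂ) • spinDot ^ 2

/-- `P = (2/3 + h) / 2`. -/
def bondP : BondOp := (1 / 2 : ℂ) • ((2 / 3 : ℂ) • (1 : BondOp) + bondH)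

/-- The bond operator `A` acting on the sites `k`, `k + 1` of the ring (addition in `Fin n` is
cyclic), tensored with the identity on all other sites. -/
def onBond {n : ℕ} [NeZero n] (k : Fin n) (A : BondOp) : ChainOp n :=
  Matrix.of fun s t =>
    if ∀ j, j ≠ k → j ≠ k + 1 → s j = t j then A (s k, s (k + 1)) (t k, t (k + 1)) else 0

/-- `X` acts nontrivially at most on the two neighbouring sites `k`, `k + 1`. -/
def ActsOnBond {n : ℕ} [NeZero n] (k : Fin n) (X : ChainOp n) : Prop :=
  ∃ A : BondOp, X = onBond k A

/-- The AKLT Hamiltonian of the ring of `n` spins. -/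
def hamiltonian (n : ℕ) [NeZero n] : ChainOp n := ∑ k : Fin n, onBond k bondH

section General

variable {ι : Type*} [Fintype ι]

/-- Normalised vectors. -/
def IsUnit (ψ : ι → ℂ) : Prop := star ψ ⬝ᵥ ψ = 1

/-- The rank-one operator `|ψ⟩⟨ψ|`. -/
def proj (ψ : ι → ℂ) : Matrix ι ι ℂ := Matrix.vecMulVec ψ (star ψ)

/-- Density matrices, i.e. (mixed) states. -/
def IsDensity (ρ : Matrix ι ι ℂ) : Prop := ρ.PosSemidef ∧ ρ.trace = 1

/-- Normalised eigenvectors for the smallest eigenvalue. -/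
def IsGroundState (H : Matrix ι ι ℂ) (ψ : ι → ℂ) : Prop :=
  IsUnit ψ ∧ ∃ E : ℝ, H *ᵥ ψ = (E : ℂ) • ψ ∧
    ∀ (E' : ℝ) (φ : ι → ℂ), φ ≠ 0 → H *ᵥ φ = (E' : ℂ) • φ → E ≤ E'

/-- The generator of the master equation with Hamiltonian `H`, jump operators `c l` and
rates `g l`. -/
def lindblad {κ : Type*} [Fintype κ] (H : Matrix ι ι ℂ) (g : κ → ℝ) (c : κ → Matrix ι ι ℂ)
    (ρ : Matrix ι ι ℂ) : Matrix ι ι ℂ :=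
  -Complex.I • (H * ρ - ρ * H) +
    ∑ l, (g l : ℂ) • ((2 : ℂ) • (c l * ρ * (c l)ᴴ) - (c l)ᴴ * c l * ρ - ρ * ((c l)ᴴ * c l))

end General

/-- The family `U` consists of unitaries and twirls: its average is the completely depolarizing
map of the bond. -/
def IsTwirl {N : ℕ} (U : Fin N → BondOp) : Prop :=
  (∀ α, U α ∈ Matrix.unitaryGroup (Fin 3 × Fin 3) ℂ) ∧
    ∀ ρ : BondOp, (1 / N : ℂ) • ∑ α, (U α)ᴴ * ρ * U α = (1 / 9 : ℂ) • (ρ.trace • (1 : BondOp))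

/-- The jump operators `c_k^α = U_k^α P_k`. -/
def jump {n : ℕ} [NeZero n] {N : ℕ} (U : Fin n → Fin N → BondOp) (l : Fin n × Fin N) :
    ChainOp n :=
  onBond l.1 (U l.1 l.2) * onBond l.1 bondP

/-- The completely positive map `X ↦ ∑_α (c_k^α)† X c_k^α`. -/
def cpMap {n : ℕ} [NeZero n] {N : ℕ} (U : Fin n → Fin N → BondOp) (k : Fin n)
    (X : ChainOp n) : ChainOp n :=
  ∑ α, (jump U (k, α))ᴴ * X * jump U (k, α)

/-- The maps `cpMap U j` applied once each, in the cyclic order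
`j = k + 1, k + 2, …, k + n = k` (the last one applied is the one of bond `k`). -/
def sweep {n : ℕ} [NeZero n] {N : ℕ} (U : Fin n → Fin N → BondOp) (k : Fin n)
    (X : ChainOp n) : ChainOp n :=
  (List.ofFn fun j : Fin n => k + 1 + j).foldl (fun Y j => cpMap U j Y) X

/-- The single jump operator
`|Ψ₁⟩⟨Φ₁| + |Ψ₂⟩⟨Φ₂| + |Ψ₃⟩⟨Φ₃| + |Ψ₄⟩⟨Φ₄| + |Φ₄⟩⟨Φ₅|` of a bond. -/
def ladder (Φ : Fin 5 → Fin 3 × Fin 3 → ℂ) (Ψ : Fin 4 → Fin 3 × Fin 3 → ℂ) : BondOp :=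
  (∑ i : Fin 4, Matrix.vecMulVec (Ψ i) (star (Φ i.castSucc))) +
    Matrix.vecMulVec (Φ 3) (star (Φ 4))

/-- `Φ` and `Ψ` are orthonormal bases of the eigenspaces of `bondH` for `4/3` and `-2/3`. -/
def IsEigenbasis (Φ : Fin 5 → Fin 3 × Fin 3 → ℂ) (Ψ : Fin 4 → Fin 3 × Fin 3 → ℂ) : Prop :=
  (∀ i j, star (Φ i) ⬝ᵥ Φ j = if i = j then 1 else 0) ∧
  (∀ i j, star (Ψ i) ⬝ᵥ Ψ j = if i = j then 1 else 0) ∧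
  (∀ i, bondH *ᵥ Φ i = (4 / 3 : ℂ) • Φ i) ∧ (∀ i, bondH *ᵥ Ψ i = (-2 / 3 : ℂ) • Ψ i)

end AKLT

end

/-! On total spin 2, 1, 0 the coupling D = `spinDot` takes the values 1, -1, -2, so `bondP` = (D +
1)(D + 2)/6 projects onto spin 2, and h = 2P - 2/3. The energy of φ is therefore -2n/3 times its
squared norm plus twice the sum of the ‖P_k φ‖² (`energy_eq`), and all statements about ground
states and dark states reduce to the common kernel of the P_k.

That kernel is a line. On an open chain the bond conditions force the amplitudes to be tr(X A_w),
with A_w a product of the 2×2 matrices `mpsMat` (`IsOpenLow.exists_trace`). Cutting the ring at two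
adjacent places gives X and Y with X A_a = A_a Y for all a, which forces X to be scalar
(`eq_smul_mps`). Conversely, the trace state is translation invariant and is killed by every P_k
(`onBond_bondP_mulVec_mps`).

For uniqueness among mixed states, let ρ ≥ 0 be stationary. If ρv = 0, or if v is dark, then ⟨v,
L(ρ)v⟩ is a positive combination of the numbers ⟨c†v, ρ c†v⟩ ≥ 0, so ρ c†v = 0
(`mulVec_conjTranspose_eq_zero`). Hence ρ annihilates whatever the maps X ↦ ∑ c†Xc make out of
|Ψ⟩⟨Ψ|. By the twirl, such a map erases the two sites of its bond and leaves P_k there, so one turn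
around the ring yields C P_k with C > 0 (`exists_sweep_eq`). Thus ρP_k = 0 for all k, and ρ lives on
the line of Ψ.

With one jump operator per bond, a pure stationary state is a common eigenvector of all of them
(`mulVec_eq_smul_of_lindblad_proj`). Since `ladder` is nilpotent, the eigenvalues vanish and the
state is dark. -/

noncomputable section

namespace AKLT

/-! ### Algebra of a single bond, reduced to decidable identities of integer matrices -/

/-- `S^z` as an integer matrix. -/
def szInt : Matrix (Fin 3) (Fin 3) ℤ := !![1, 0, 0; 0, 0, 0; 0, 0, -1]

/-- The raising operator divided by `√2`, as an integer matrix. -/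
def raiseInt : Matrix (Fin 3) (Fin 3) ℤ := !![0, 1, 0; 0, 0, 1; 0, 0, 0]

/-- The coupling of two spins as an integer matrix. -/
def dotInt : Matrix (Fin 3 × Fin 3) (Fin 3 × Fin 3) ℤ :=
  szInt ⊗ₖ szInt + raiseInt ⊗ₖ raiseIntᵀ + raiseIntᵀ ⊗ₖ raiseInt

/-- Six times the projector onto total spin 2, as an integer matrix. -/
def projInt : Matrix (Fin 3 × Fin 3) (Fin 3 × Fin 3) ℤ :=
  Matrix.of fun p q =>
    if p = q then (if p.1 = p.2 then if p.1 = 1 then 4 else 6 else if p.1 = 1 ∨ p.2 = 1 then 3 else 1)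
    else if p = q.swap then (if p.1 = 1 ∨ p.2 = 1 then 3 else 1)
    else if p.1.val + p.2.val = 2 ∧ q.1.val + q.2.val = 2 then 2 else 0

lemma projInt_eq : projInt = dotInt * dotInt + 3 * dotInt + 2 := by decide
lemma projInt_mul_self : projInt * projInt = 6 * projInt := by decide
lemma dotInt_mul_projInt : dotInt * projInt = projInt := by decide
lemma projInt_transpose : projIntᵀ = projInt := by decide
lemma trace_projInt : projInt.trace = 30 := by decide
-- The partial trace of the spin-2 projector over one site is 5/3 times the identity. This is what
-- makes each step of the sweep forget the preceding projector.
lemma sum_projInt_right (i c : Fin 3) :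
    ∑ a, projInt (i, a) (c, a) = if i = c then 10 else 0 := by
  revert i c; decide

/-- The entrywise cast of integer matrices to complex ones. -/
abbrev castC : Matrix (Fin 3 × Fin 3) (Fin 3 × Fin 3) ℤ →+* BondOp := (Int.castRingHom ℂ).mapMatrix

lemma sqrt_two_inv_sq : ((1 / Real.sqrt 2 : ℝ) : ℂ) * ((1 / Real.sqrt 2 : ℝ) : ℂ) = 1 / 2 := by
  rw [← Complex.ofReal_mul, div_mul_div_comm, Real.mul_self_sqrt (by norm_num)]
  norm_num

lemma Sx_eq : Sx = ((1 / Real.sqrt 2 : ℝ) : ℂ) •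
    (raiseInt.map (Int.cast : ℤ → ℂ) + raiseIntᵀ.map (Int.cast : ℤ → ℂ)) := by
  unfold Sx
  congr 1
  ext i j; fin_cases i <;> fin_cases j <;> simp [raiseInt]

lemma Sy_eq : Sy = ((1 / Real.sqrt 2 : ℝ) : ℂ) • Complex.I •
    (raiseIntᵀ.map (Int.cast : ℤ → ℂ) - raiseInt.map (Int.cast : ℤ → ℂ)) := by
  unfold Sy
  congr 1
  ext i j; fin_cases i <;> fin_cases j <;> simp [raiseInt]

lemma Sz_eq : Sz = szInt.map (Int.cast : ℤ → ℂ) := by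
  unfold Sz
  ext i j; fin_cases i <;> fin_cases j <;> simp [szInt]

lemma spinDot_eq : spinDot = castC dotInt := by
  ext ⟨a, b⟩ ⟨c, d⟩
  have h := sqrt_two_inv_sq
  simp only [spinDot, Sx_eq, Sy_eq, Sz_eq, dotInt, Matrix.add_apply, Matrix.kroneckerMap_apply,
    Matrix.smul_apply, Matrix.sub_apply, Matrix.map_apply, smul_eq_mul, RingHom.mapMatrix_apply,
    Int.coe_castRingHom, Int.cast_add, Int.cast_mul]
  set r := ((1 / Real.sqrt 2 : ℝ) : ℂ)
  generalize (raiseInt a c : ℂ) = x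
  generalize (raiseIntᵀ a c : ℂ) = x'
  generalize (raiseInt b d : ℂ) = y
  generalize (raiseIntᵀ b d : ℂ) = y'
  have e : r * (x + x') * (r * (y + y')) + r * (Complex.I * (x' - x)) * (r * (Complex.I * (y' - y)))
      = r * r * ((x + x') * (y + y') + (Complex.I * Complex.I) * ((x' - x) * (y' - y))) := by ring
  rw [e, h, Complex.I_mul_I]
  ring

lemma bondP_eq_add : bondP = (1 / 6 : ℂ) • (spinDot * spinDot + 3 * spinDot + 2) := by
  have h3 : (3 : BondOp) * spinDot = (3 : ℂ) • spinDot := by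
    rw [← map_ofNat (algebraMap ℂ BondOp) 3, Algebra.algebraMap_eq_smul_one, smul_one_mul]
  have h2 : (2 : BondOp) = (2 : ℂ) • 1 := by
    rw [← map_ofNat (algebraMap ℂ BondOp) 2, Algebra.algebraMap_eq_smul_one]
  rw [h3, h2, bondP, bondH, pow_two]
  module

lemma bondP_eq : bondP = (1 / 6 : ℂ) • castC projInt := by
  rw [bondP_eq_add, projInt_eq, spinDot_eq]
  simp only [map_add, map_mul, map_ofNat]

lemma bondP_apply (p q : Fin 3 × Fin 3) : bondP p q = (projInt p q : ℂ) / 6 := by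
  rw [bondP_eq, Matrix.smul_apply, smul_eq_mul, RingHom.mapMatrix_apply, Matrix.map_apply]
  simp only [Int.coe_castRingHom]; ring

lemma bondH_eq : bondH = (2 : ℂ) • bondP - (2 / 3 : ℂ) • 1 := by
  rw [bondP]; module

lemma bondP_isHermitian : bondP.IsHermitian := by
  ext p q
  rw [Matrix.conjTranspose_apply, bondP_apply, bondP_apply]
  have h : projInt q p = projInt p q := congrFun (congrFun projInt_transpose p) q
  simp [h]

lemma bondP_mul_self : bondP * bondP = bondP := by
  rw [bondP_eq, smul_mul_smul_comm, ← map_mul, projInt_mul_self, map_mul, map_ofNat,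
    ← map_ofNat (algebraMap ℂ BondOp) 6, Algebra.algebraMap_eq_smul_one, smul_one_mul, smul_smul]
  norm_num

lemma spinDot_mul_bondP : spinDot * bondP = bondP := by
  rw [bondP_eq, spinDot_eq, mul_smul_comm, ← map_mul, dotInt_mul_projInt]

lemma trace_bondP : bondP.trace = 5 := by
  have := congrArg (Int.cast : ℤ → ℂ) trace_projInt
  simp only [Matrix.trace, Matrix.diag, Int.cast_sum] at this ⊢
  simp only [bondP_apply, ← Finset.sum_div, this]
  norm_num

lemma sum_bondP_right (i c : Fin 3) :
    ∑ a, bondP (i, a) (c, a) = if i = c then (5 / 3 : ℂ) else 0 := by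
  have := congrArg (Int.cast : ℤ → ℂ) (sum_projInt_right i c)
  simp only [Int.cast_sum] at this
  simp only [bondP_apply, ← Finset.sum_div, this]
  split_ifs <;> norm_num

lemma bondH_mulVec (v : Fin 3 × Fin 3 → ℂ) :
    bondH *ᵥ v = (2 : ℂ) • (bondP *ᵥ v) - (2 / 3 : ℂ) • v := by
  rw [bondH_eq, Matrix.sub_mulVec, Matrix.smul_mulVec, Matrix.smul_mulVec, Matrix.one_mulVec]

lemma bondP_mulVec_eq_self_iff (v : Fin 3 × Fin 3 → ℂ) :
    bondP *ᵥ v = v ↔ bondH *ᵥ v = (4 / 3 : ℂ) • v := by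
  rw [bondH_mulVec]
  constructor
  · intro h; rw [h]; module
  · intro h
    have : (2 : ℂ) • (bondP *ᵥ v) = (2 : ℂ) • v := by
      rw [sub_eq_iff_eq_add] at h; rw [h]; module
    exact (smul_right_injective _ two_ne_zero) this

lemma bondP_mulVec_eq_zero_iff (v : Fin 3 × Fin 3 → ℂ) :
    bondP *ᵥ v = 0 ↔ bondH *ᵥ v = (-2 / 3 : ℂ) • v := by
  rw [bondH_mulVec]
  constructor
  · intro h; rw [h]; module
  · intro h
    have : (2 : ℂ) • (bondP *ᵥ v) = (2 : ℂ) • 0 := by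
      rw [sub_eq_iff_eq_add] at h; rw [h]; module
    exact (smul_right_injective _ two_ne_zero) this

lemma spinDot_mulVec_eq_self_iff (v : Fin 3 × Fin 3 → ℂ) :
    spinDot *ᵥ v = v ↔ bondP *ᵥ v = v := by
  constructor
  · intro h
    have h2 : (2 : BondOp) = (2 : ℂ) • 1 := by
      rw [← map_ofNat (algebraMap ℂ BondOp) 2, Algebra.algebraMap_eq_smul_one]
    have h3 : (3 : BondOp) = (3 : ℂ) • 1 := by
      rw [← map_ofNat (algebraMap ℂ BondOp) 3, Algebra.algebraMap_eq_smul_one]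
    rw [bondP_eq_add, h2, h3]
    simp only [Matrix.smul_mulVec, Matrix.add_mulVec, ← Matrix.mulVec_mulVec, h, Matrix.one_mulVec]
    module
  · intro h
    rw [← h, Matrix.mulVec_mulVec, spinDot_mul_bondP]

lemma spin_sq_sum : Sx * Sx + Sy * Sy + Sz * Sz = (2 : ℂ) • 1 := by
  have h := sqrt_two_inv_sq
  simp only [Sx, Sy, Sz, smul_mul_smul_comm, h]
  ext i j; fin_cases i <;> fin_cases j <;>
    simp <;> norm_num

lemma totalComp_sq (S : Matrix (Fin 3) (Fin 3) ℂ) :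
    totalComp S ^ 2 = (S * S) ⊗ₖ 1 + 1 ⊗ₖ (S * S) + (2 : ℂ) • (S ⊗ₖ S) := by
  rw [pow_two, totalComp, add_mul, mul_add, mul_add, ← Matrix.mul_kronecker_mul,
    ← Matrix.mul_kronecker_mul, ← Matrix.mul_kronecker_mul, ← Matrix.mul_kronecker_mul]
  simp only [mul_one, one_mul]
  module

/-- The constant 4 is s(s + 1) = 2 for each of the two spins. -/
lemma totalSpinSq_eq : totalSpinSq = (4 : ℂ) • 1 + (2 : ℂ) • spinDot := by
  have e : totalSpinSq = (Sx * Sx + Sy * Sy + Sz * Sz) ⊗ₖ 1 + 1 ⊗ₖ (Sx * Sx + Sy * Sy + Sz * Sz)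
      + (2 : ℂ) • spinDot := by
    simp only [totalSpinSq, totalComp_sq, spinDot, Matrix.add_kronecker, Matrix.kronecker_add]
    module
  rw [e, spin_sq_sum, Matrix.smul_kronecker, Matrix.kronecker_smul, Matrix.one_kronecker_one]
  module

lemma totalSpinSq_mulVec_iff (v : Fin 3 × Fin 3 → ℂ) :
    bondH *ᵥ v = (4 / 3 : ℂ) • v ↔ totalSpinSq *ᵥ v = (6 : ℂ) • v := by
  rw [← bondP_mulVec_eq_self_iff, ← spinDot_mulVec_eq_self_iff, totalSpinSq_eq, Matrix.add_mulVec,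
    Matrix.smul_mulVec, Matrix.smul_mulVec, Matrix.one_mulVec]
  constructor
  · intro h; rw [h]; module
  · intro h
    have : (2 : ℂ) • (spinDot *ᵥ v) = (2 : ℂ) • v := by
      rw [← sub_eq_zero] at h ⊢; rw [← h]; module
    exact (smul_right_injective _ two_ne_zero) this

lemma finrank_range_bondP : Module.finrank ℂ (LinearMap.range (Matrix.toLin' bondP)) = 5 := by
  have hp : LinearMap.IsProj (LinearMap.range (Matrix.toLin' bondP)) (Matrix.toLin' bondP) := by
    refine ⟨fun x => ⟨x, rfl⟩, ?_⟩
    rintro _ ⟨y, rfl⟩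
    simp only [Matrix.toLin'_apply, Matrix.mulVec_mulVec, bondP_mul_self]
  have h := hp.trace
  rw [Matrix.trace_toLin'_eq, trace_bondP] at h
  exact_mod_cast h.symm

lemma eigenspace_four_thirds :
    Module.End.eigenspace (Matrix.toLin' bondH) (4 / 3 : ℂ) =
      LinearMap.range (Matrix.toLin' bondP) := by
  ext v
  rw [Module.End.mem_eigenspace_iff, Matrix.toLin'_apply, ← bondP_mulVec_eq_self_iff]
  constructor
  · intro h; exact ⟨v, h⟩
  · rintro ⟨y, rfl⟩
    simp only [Matrix.toLin'_apply, Matrix.mulVec_mulVec, bondP_mul_self]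

lemma eigenspace_neg_two_thirds :
    Module.End.eigenspace (Matrix.toLin' bondH) (-2 / 3 : ℂ) =
      LinearMap.ker (Matrix.toLin' bondP) := by
  ext v
  rw [Module.End.mem_eigenspace_iff, Matrix.toLin'_apply, ← bondP_mulVec_eq_zero_iff,
    LinearMap.mem_ker, Matrix.toLin'_apply]

lemma finrank_ker_bondP : Module.finrank ℂ (LinearMap.ker (Matrix.toLin' bondP)) = 4 := by
  have h := LinearMap.finrank_range_add_finrank_ker (Matrix.toLin' bondP)
  rw [finrank_range_bondP, Module.finrank_pi] at h
  simp at h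
  omega

/-- The five linear equations cutting out the kernel of `bondP`. -/
def IsLow {M : Type*} [AddCommGroup M] (T : Fin 3 → Fin 3 → M) : Prop :=
  T 0 0 = 0 ∧ T 0 1 + T 1 0 = 0 ∧ T 0 2 + 2 • T 1 1 + T 2 0 = 0 ∧ T 1 2 + T 2 1 = 0 ∧ T 2 2 = 0

lemma bondP_mulVec_eq_zero_iff_isLow (v : Fin 3 × Fin 3 → ℂ) :
    bondP *ᵥ v = 0 ↔ IsLow (fun a b => v (a, b)) := by
  have hz : ∀ p, (bondP *ᵥ v) p = (∑ a, ∑ b, (projInt p (a, b) : ℂ) * v (a, b)) / 6 := by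
    intro p
    simp only [Matrix.mulVec, dotProduct, bondP_apply, Fintype.sum_prod_type, Finset.sum_div]
    refine Finset.sum_congr rfl fun a _ => Finset.sum_congr rfl fun b _ => by ring
  constructor
  · intro h
    have h0 : ∀ p, (∑ a, ∑ b, (projInt p (a, b) : ℂ) * v (a, b)) = 0 := fun p => by
      have := hz p
      rw [h] at this
      simpa using this.symm
    have h1 := h0 (0, 0)
    have h2 := h0 (0, 1)
    have h3 := h0 (0, 2)
    have h4 := h0 (1, 2)
    have h5 := h0 (2, 2)
    simp [Fin.sum_univ_three, projInt] at h1 h2 h3 h4 h5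
    refine ⟨h1, ?_, ?_, ?_, h5⟩
    · linear_combination h2 / 3
    · simp only [nsmul_eq_mul]; push_cast; linear_combination h3
    · linear_combination h4 / 3
  · rintro ⟨h1, h2, h3, h4, h5⟩
    simp only [nsmul_eq_mul] at h3
    push_cast at h3
    ext ⟨i, j⟩
    rw [hz]
    fin_cases i <;> fin_cases j <;> simp [Fin.sum_univ_three, projInt]
    · exact h1
    · linear_combination 3 * h2
    · linear_combination h3
    · linear_combination 3 * h2
    · linear_combination 2 * h3
    · linear_combination 3 * h4
    · linear_combination h3
    · linear_combination 3 * h4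
    · exact h5

/-! ### Twirling by Weyl operators of a finite abelian group -/

/-- The product of the translation by `x.1` with the diagonal matrix of the character `x.2`. -/
def weyl {G : Type*} [AddCommGroup G] [DecidableEq G] (x : G × AddChar G ℂ) : Matrix G G ℂ :=
  Matrix.of fun a b => if a = b + x.1 then x.2 b else 0

section Weyl

variable {G : Type*} [AddCommGroup G] [DecidableEq G] [Fintype G]

lemma weyl_conj_apply (x : G × AddChar G ℂ) (ρ : Matrix G G ℂ) (a b : G) :
    ((weyl x)ᴴ * ρ * weyl x) a b = x.2 (b - a) * ρ (a + x.1) (b + x.1) := by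
  simp only [Matrix.mul_apply, Matrix.conjTranspose_apply, weyl, Matrix.of_apply, mul_ite, mul_zero,
    Finset.sum_ite_eq', Finset.mem_univ, if_true, apply_ite (star : ℂ → ℂ), star_zero, ite_mul, zero_mul]
  rw [sub_eq_add_neg, AddChar.map_add_eq_mul, AddChar.map_neg_eq_conj]
  simp only [Complex.star_def]
  ring

lemma weyl_mem_unitaryGroup (x : G × AddChar G ℂ) : weyl x ∈ Matrix.unitaryGroup G ℂ := by
  rw [Matrix.mem_unitaryGroup_iff', Matrix.star_eq_conjTranspose]
  ext a b
  have := weyl_conj_apply x 1 a b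
  rw [mul_one] at this
  rw [this, Matrix.one_apply, Matrix.one_apply]
  by_cases h : a = b
  · subst h; simp
  · simp [h]

/-- Summing over characters kills the off-diagonal entries by orthogonality; summing over
translations turns each diagonal entry into the trace. -/
lemma sum_weyl_conj (ρ : Matrix G G ℂ) :
    ∑ x : G × AddChar G ℂ, (weyl x)ᴴ * ρ * weyl x =
      (Fintype.card G : ℂ) • (ρ.trace • (1 : Matrix G G ℂ)) := by
  ext a b
  rw [Matrix.sum_apply]
  simp only [weyl_conj_apply, Fintype.sum_prod_type, ← Finset.sum_mul, AddChar.sum_apply_eq_ite,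
    Matrix.smul_apply, Matrix.one_apply, sub_eq_zero]
  by_cases h : a = b
  · subst h
    simp only [if_true, ← Finset.mul_sum, smul_eq_mul, mul_one]
    congr 1
    exact Fintype.sum_equiv (Equiv.addLeft a) _ _ fun _ => rfl
  · simp [h, Ne.symm h]

end Weyl

lemma exists_isTwirl : ∃ (N : ℕ) (U : Fin N → BondOp), IsTwirl U := by
  let G := Fin 3 × Fin 3
  let e := Fintype.equivFin (G × AddChar G ℂ)
  refine ⟨_, fun i => weyl (e.symm i), fun i => weyl_mem_unitaryGroup _, fun ρ => ?_⟩
  rw [Fintype.sum_equiv e.symm _ (fun x => (weyl x)ᴴ * ρ * weyl x) (fun _ => rfl), sum_weyl_conj,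
    smul_smul]
  -- The family has 9 · 9 members and the sum carries a factor 9, which leaves 1/9.
  congr 1
  rw [Fintype.card_prod, AddChar.card_eq]
  simp [G]
  norm_num

lemma IsTwirl.pos {N : ℕ} {U : Fin N → BondOp} (h : IsTwirl U) : 0 < N := by
  rcases Nat.eq_zero_or_pos N with rfl | h'
  · have := congrFun (congrFun (h.2 1) 0) 0
    simp at this
  · exact h'

lemma IsTwirl.sum_conj {N : ℕ} {U : Fin N → BondOp} (h : IsTwirl U) (ρ : BondOp) :
    ∑ α, (U α)ᴴ * ρ * U α = ((N : ℂ) / 9 * ρ.trace) • 1 := by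
  have h1 := h.2 ρ
  have hN : (N : ℂ) ≠ 0 := by exact_mod_cast h.pos.ne'
  have h2 := congrArg (fun X => (N : ℂ) • X) h1
  simp only [smul_smul] at h2
  rw [mul_one_div_cancel hN, one_smul] at h2
  rw [h2]
  congr 1
  ring

/-! ### Bond operators on the ring -/

section Ring

variable {n : ℕ} [NeZero n]

/-- The configuration `s` with the spins of the bond `k`, `k + 1` replaced by `p`. -/
def setBond (k : Fin n) (s : Fin n → Fin 3) (p : Fin 3 × Fin 3) : Fin n → Fin 3 :=
  Function.update (Function.update s k p.1) (k + 1) p.2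

/-- The spins of the bond `k`, `k + 1` in the configuration `s`. -/
def getBond (k : Fin n) (s : Fin n → Fin 3) : Fin 3 × Fin 3 := (s k, s (k + 1))

/-- The configurations `s` and `t` agree outside of the bond `k`, `k + 1`. -/
def AgreeOff (k : Fin n) (s t : Fin n → Fin 3) : Prop := ∀ j, j ≠ k → j ≠ k + 1 → s j = t j

instance (k : Fin n) (s t : Fin n → Fin 3) : Decidable (AgreeOff k s t) := by
  unfold AgreeOff; infer_instance

lemma add_one_ne_self (hn : 3 ≤ n) (k : Fin n) : k + 1 ≠ k := by
  have h1 : (1 : Fin n) ≠ 0 := by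
    intro h
    have := congrArg Fin.val h
    rw [Fin.val_one', Fin.val_zero, Nat.mod_eq_of_lt (by omega)] at this
    exact one_ne_zero this
  simpa using h1

lemma onBond_apply (k : Fin n) (A : BondOp) (s t : Fin n → Fin 3) :
    onBond k A s t = if AgreeOff k s t then A (getBond k s) (getBond k t) else 0 := rfl

lemma AgreeOff.refl (k : Fin n) (s : Fin n → Fin 3) : AgreeOff k s s := fun _ _ _ => rfl

lemma AgreeOff.symm {k : Fin n} {s t : Fin n → Fin 3} (h : AgreeOff k s t) : AgreeOff k t s :=
  fun j h1 h2 => (h j h1 h2).symm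

lemma setBond_agreeOff (k : Fin n) (s : Fin n → Fin 3) (p : Fin 3 × Fin 3) :
    AgreeOff k (setBond k s p) s := fun j h1 h2 => by simp [setBond, h1, h2]

lemma agreeOff_setBond_left {k : Fin n} {s t : Fin n → Fin 3} {p : Fin 3 × Fin 3} :
    AgreeOff k (setBond k s p) t ↔ AgreeOff k s t := by
  constructor <;> intro h j h1 h2
  · rw [← h j h1 h2, setBond_agreeOff k s p j h1 h2]
  · rw [← h j h1 h2, setBond_agreeOff k s p j h1 h2]

lemma getBond_setBond {k : Fin n} (hk : k + 1 ≠ k) (s : Fin n → Fin 3) (p : Fin 3 × Fin 3) :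
    getBond k (setBond k s p) = p := by
  simp [getBond, setBond, hk.symm]

lemma setBond_getBond {k : Fin n} {s t : Fin n → Fin 3} (h : AgreeOff k s t) :
    setBond k s (getBond k t) = t := by
  ext1 j
  by_cases h2 : j = k + 1
  · subst h2; simp [setBond, getBond]
  by_cases h1 : j = k
  · subst h1; simp [setBond, getBond, h2]
  simp [setBond, h1, h2, h j h1 h2]

lemma setBond_setBond {k : Fin n} (hk : k + 1 ≠ k) (s : Fin n → Fin 3) (p q : Fin 3 × Fin 3) :
    setBond k (setBond k s p) q = setBond k s q := by
  have h : AgreeOff k (setBond k s p) (setBond k s q) :=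
    agreeOff_setBond_left.2 (setBond_agreeOff k s q).symm
  have := setBond_getBond h
  rwa [getBond_setBond hk] at this

lemma setBond_self (k : Fin n) (s : Fin n → Fin 3) : setBond k s (getBond k s) = s :=
  setBond_getBond (AgreeOff.refl k s)

lemma sum_agreeOff {M : Type*} [AddCommMonoid M] {k : Fin n} (hk : k + 1 ≠ k)
    (s : Fin n → Fin 3) (F : (Fin n → Fin 3) → M) :
    (∑ u, if AgreeOff k s u then F u else 0) = ∑ p, F (setBond k s p) := by
  rw [← Finset.sum_filter]
  symm
  refine Finset.sum_bij' (fun p _ => setBond k s p) (fun u _ => getBond k u) ?_ ?_ ?_ ?_ ?_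
  · intro p _; simpa using (setBond_agreeOff k s p).symm
  · intro u _; simp
  · intro p _; exact getBond_setBond hk s p
  · intro u hu; exact setBond_getBond (by simpa using hu)
  · intro p _; rfl

lemma onBond_mul_apply {k : Fin n} (hk : k + 1 ≠ k) (A : BondOp) {κ : Type*}
    (X : Matrix (Fin n → Fin 3) κ ℂ) (s : Fin n → Fin 3) (t : κ) :
    (onBond k A * X) s t = ∑ p, A (getBond k s) p * X (setBond k s p) t := by
  rw [Matrix.mul_apply]
  simp only [onBond_apply, ite_mul, zero_mul]
  rw [sum_agreeOff hk]
  simp only [getBond_setBond hk]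

lemma onBond_mulVec_apply {k : Fin n} (hk : k + 1 ≠ k) (A : BondOp) (φ : ChainVec n)
    (s : Fin n → Fin 3) :
    (onBond k A *ᵥ φ) s = (A *ᵥ fun p => φ (setBond k s p)) (getBond k s) := by
  rw [Matrix.mulVec, dotProduct]
  simp only [onBond_apply, ite_mul, zero_mul]
  rw [sum_agreeOff hk]
  simp only [getBond_setBond hk]
  rfl

lemma onBond_conjTranspose (k : Fin n) (A : BondOp) : (onBond k A)ᴴ = onBond k Aᴴ := by
  ext s t
  rw [Matrix.conjTranspose_apply, onBond_apply, onBond_apply, Matrix.conjTranspose_apply]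
  by_cases h : AgreeOff k s t
  · rw [if_pos h, if_pos h.symm]
  · rw [if_neg h, if_neg (fun h' => h h'.symm), star_zero]

lemma mul_onBond_apply {k : Fin n} (hk : k + 1 ≠ k) (A : BondOp) {κ : Type*}
    (X : Matrix κ (Fin n → Fin 3) ℂ) (s : κ) (t : Fin n → Fin 3) :
    (X * onBond k A) s t = ∑ p, X s (setBond k t p) * A p (getBond k t) := by
  have h : (X * onBond k A) s t = star ((onBond k Aᴴ * Xᴴ) t s) := by
    rw [← onBond_conjTranspose, ← Matrix.conjTranspose_mul, Matrix.conjTranspose_apply, star_star]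
  rw [h, onBond_mul_apply hk, star_sum]
  simp only [star_mul', Matrix.conjTranspose_apply, star_star, mul_comm]

lemma onBond_mul {k : Fin n} (hk : k + 1 ≠ k) (A B : BondOp) :
    onBond k (A * B) = onBond k A * onBond k B := by
  ext s t
  rw [onBond_mul_apply hk, onBond_apply]
  simp only [onBond_apply, agreeOff_setBond_left, getBond_setBond hk]
  by_cases h : AgreeOff k s t
  · simp [h, Matrix.mul_apply]
  · simp [h]

lemma onBond_one (k : Fin n) : onBond k (1 : BondOp) = 1 := by
  ext s t
  rw [onBond_apply, Matrix.one_apply, Matrix.one_apply]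
  by_cases h : s = t
  · subst h; simp [AgreeOff.refl]
  · rw [if_neg h]
    split_ifs with h1 h2
    · exact (h (by rw [← setBond_getBond h1, ← h2, setBond_self])).elim
    · rfl
    · rfl

lemma onBond_smul (k : Fin n) (c : ℂ) (A : BondOp) : onBond k (c • A) = c • onBond k A := by
  ext s t
  simp only [onBond_apply, Matrix.smul_apply]
  split_ifs <;> simp

lemma onBond_sub (k : Fin n) (A B : BondOp) : onBond k (A - B) = onBond k A - onBond k B := by
  ext s t
  simp only [onBond_apply, Matrix.sub_apply]
  split_ifs <;> simp

lemma onBond_zero (k : Fin n) : onBond k 0 = 0 := by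
  ext s t
  simp [onBond_apply]

lemma onBond_bondP_isHermitian (k : Fin n) : (onBond k bondP).IsHermitian := by
  rw [Matrix.IsHermitian, onBond_conjTranspose, bondP_isHermitian]

lemma onBond_bondP_mul_self {k : Fin n} (hk : k + 1 ≠ k) :
    onBond k bondP * onBond k bondP = onBond k bondP := by
  rw [← onBond_mul hk, bondP_mul_self]

lemma onBond_bondH (k : Fin n) :
    onBond k bondH = (2 : ℂ) • onBond k bondP - (2 / 3 : ℂ) • 1 := by
  rw [bondH_eq, onBond_sub, onBond_smul, onBond_smul, onBond_one]

lemma onBond_mulVec_eq_zero_of_unitary {k : Fin n} (hk : k + 1 ≠ k) {V : BondOp}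
    (hV : V ∈ Matrix.unitaryGroup (Fin 3 × Fin 3) ℂ) (φ : ChainVec n) :
    (onBond k V * onBond k bondP) *ᵥ φ = 0 ↔ onBond k bondP *ᵥ φ = 0 := by
  rw [← Matrix.mulVec_mulVec]
  constructor
  · intro h
    have h2 := congrArg (fun v => onBond k (star V) *ᵥ v) h
    simp only [Matrix.mulVec_mulVec, Matrix.mulVec_zero] at h2
    rwa [← mul_assoc, ← onBond_mul hk, Matrix.mem_unitaryGroup_iff'.1 hV, onBond_one,
      one_mul] at h2
  · intro h; rw [h, Matrix.mulVec_zero]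

/-- With the spins outside the bond frozen, φ is a two-spin vector, and the operator acts on each
such vector separately. -/
lemma onBond_bondP_mulVec_eq_zero_iff {k : Fin n} (hk : k + 1 ≠ k) (φ : ChainVec n) :
    onBond k bondP *ᵥ φ = 0 ↔ ∀ s, IsLow fun a b => φ (setBond k s (a, b)) := by
  have e : ∀ s, (IsLow fun a b => φ (setBond k s (a, b))) ↔
      bondP *ᵥ (fun p => φ (setBond k s p)) = 0 :=
    fun s => (bondP_mulVec_eq_zero_iff_isLow fun p => φ (setBond k s p)).symm
  simp only [e]
  constructor
  · intro h s
    ext p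
    have := congrFun h (setBond k s p)
    rw [onBond_mulVec_apply hk, getBond_setBond hk] at this
    simp only [setBond_setBond hk] at this
    exact this
  · intro h
    ext s
    rw [onBond_mulVec_apply hk, h s]
    rfl

end Ring

/-! ### Matrix product form of vectors on an open chain -/

/-- The matrices of the matrix product form of the AKLT state. -/
def mpsMat : Fin 3 → Matrix (Fin 2) (Fin 2) ℂ :=
  ![!![0, 1; 0, 0], !![1, 0; 0, -1], !![0, 0; -2, 0]]

/-- The product of the matrices `mpsMat` along a word. -/
def mpsProd (w : List (Fin 3)) : Matrix (Fin 2) (Fin 2) ℂ := (w.map mpsMat).prod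

lemma mpsProd_nil : mpsProd [] = 1 := rfl

lemma mpsProd_cons (a : Fin 3) (w : List (Fin 3)) : mpsProd (a :: w) = mpsMat a * mpsProd w := by
  simp [mpsProd]

lemma mpsProd_append (u v : List (Fin 3)) : mpsProd (u ++ v) = mpsProd u * mpsProd v := by
  simp [mpsProd]

lemma mpsMat_zero : mpsMat 0 = !![0, 1; 0, 0] := rfl
lemma mpsMat_one : mpsMat 1 = !![1, 0; 0, -1] := rfl
lemma mpsMat_two : mpsMat 2 = !![0, 0; -2, 0] := rfl

lemma mpsMat_one_mul_self : mpsMat 1 * mpsMat 1 = 1 := by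
  rw [mpsMat_one]
  ext i j; fin_cases i <;> fin_cases j <;> simp

lemma IsLow.map {M N : Type*} [AddCommGroup M] [AddCommGroup N] {T : Fin 3 → Fin 3 → M}
    (h : IsLow T) (f : M →+ N) : IsLow fun a b => f (T a b) := by
  obtain ⟨h1, h2, h3, h4, h5⟩ := h
  refine ⟨?_, ?_, ?_, ?_, ?_⟩
  · change f (T 0 0) = 0
    rw [h1, map_zero]
  · rw [← map_add, h2, map_zero]
  · rw [← map_nsmul, ← map_add, ← map_add, h3, map_zero]
  · rw [← map_add, h4, map_zero]
  · change f (T 2 2) = 0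
    rw [h5, map_zero]

lemma isLow_mpsMat : IsLow fun a b => mpsMat a * mpsMat b := by
  simp only [IsLow, mpsMat_zero, mpsMat_one, mpsMat_two]
  refine ⟨?_, ?_, ?_, ?_, ?_⟩ <;>
  · ext i j; fin_cases i <;> fin_cases j <;> simp

section Span

variable {Z : Matrix (Fin 2) (Fin 2) ℂ}

/-- The three matrices span the traceless matrices, whose orthogonal complement under the trace form
is the scalars. -/
lemma eq_smul_one_of_trace_mul_mpsMat (h : ∀ a, (Z * mpsMat a).trace = 0) :
    ∃ c : ℂ, Z = c • 1 := by
  have h0 := h 0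
  have h1 := h 1
  have h2 := h 2
  simp [mpsMat_zero, mpsMat_one, mpsMat_two, Matrix.trace, Matrix.mul_apply, Fin.sum_univ_two]
    at h0 h1 h2
  refine ⟨Z 0 0, ?_⟩
  ext i j; fin_cases i <;> fin_cases j <;> simp [h0, h2]
  linear_combination -h1

lemma eq_zero_of_mul_mpsMat (h : ∀ a, Z * mpsMat a = 0) : Z = 0 := by
  rw [← mul_one Z, ← mpsMat_one_mul_self, ← mul_assoc, h, zero_mul]

/-- Products of a fixed length m ≥ 2 span all 2×2 matrices: length 2 already does, and `mpsMat 1` is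
invertible. -/
lemma eq_zero_of_trace_mul_mpsProd {m : ℕ} (hm : 2 ≤ m)
    (h : ∀ w : List (Fin 3), w.length = m → (Z * mpsProd w).trace = 0) : Z = 0 := by
  induction m, hm using Nat.le_induction generalizing Z with
  | base =>
    have e : ∀ a b, (Z * (mpsMat a * mpsMat b)).trace = 0 := fun a b => by
      have := h [a, b] rfl
      simpa [mpsProd_cons, mpsProd_nil] using this
    have h1 := e 0 2
    have h2 := e 2 0
    have h3 := e 0 1
    have h4 := e 2 1
    simp [mpsMat_zero, mpsMat_one, mpsMat_two, Matrix.trace, Matrix.mul_apply, Fin.sum_univ_two]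
      at h1 h2 h3 h4
    ext i j; fin_cases i <;> fin_cases j <;> simp [h1, h2, h3, h4]
  | succ m _ ih =>
    refine eq_zero_of_mul_mpsMat fun a => ih fun w hw => ?_
    have := h (a :: w) (by simp [hw])
    rwa [mpsProd_cons, ← mul_assoc] at this

lemma eq_smul_one_of_trace_mul_mpsProd {m : ℕ} (hm : 1 ≤ m)
    (h : ∀ w : List (Fin 3), w.length = m → (Z * mpsProd w).trace = 0) :
    ∃ c : ℂ, Z = c • 1 := by
  rcases hm.eq_or_lt with rfl | hm
  · refine eq_smul_one_of_trace_mul_mpsMat fun a => ?_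
    have := h [a] rfl
    simpa [mpsProd_cons, mpsProd_nil] using this
  · exact ⟨0, by rw [zero_smul]; exact eq_zero_of_trace_mul_mpsProd hm h⟩

end Span

lemma mul_mpsMat_zero (M : Matrix (Fin 2) (Fin 2) ℂ) :
    M * mpsMat 0 = !![0, M 0 0; 0, M 1 0] := by
  rw [mpsMat_zero]
  ext i j; fin_cases i <;> fin_cases j <;> simp [Matrix.mul_apply]

lemma mul_mpsMat_one (M : Matrix (Fin 2) (Fin 2) ℂ) :
    M * mpsMat 1 = !![M 0 0, -M 0 1; M 1 0, -M 1 1] := by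
  rw [mpsMat_one]
  ext i j; fin_cases i <;> fin_cases j <;> simp [Matrix.mul_apply]

lemma mul_mpsMat_two (M : Matrix (Fin 2) (Fin 2) ℂ) :
    M * mpsMat 2 = !![-2 * M 0 1, 0; -2 * M 1 1, 0] := by
  rw [mpsMat_two]
  ext i j; fin_cases i <;> fin_cases j <;> simp [Matrix.mul_apply, mul_comm]

/-- The induction step for open chains. Equality only up to scalars is allowed because, when a
single letter follows the first bond, its matrices test only modulo scalars. -/
lemma eq_mul_mpsMat_of_scalar {X : Fin 3 → Matrix (Fin 2) (Fin 2) ℂ}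
    (h0 : ∃ c : ℂ, X 0 * mpsMat 0 = c • 1)
    (h1 : ∃ c : ℂ, X 0 * mpsMat 1 + X 1 * mpsMat 0 = c • 1)
    (h2 : ∃ c : ℂ, X 0 * mpsMat 2 + 2 • (X 1 * mpsMat 1) + X 2 * mpsMat 0 = c • 1)
    (h3 : ∃ c : ℂ, X 1 * mpsMat 2 + X 2 * mpsMat 1 = c • 1) :
    ∃ Y, ∀ i, X i = Y * mpsMat i := by
  simp only [mul_mpsMat_zero, mul_mpsMat_one, mul_mpsMat_two] at h0 h1 h2 h3
  obtain ⟨c0, h0⟩ := h0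
  obtain ⟨c1, h1⟩ := h1
  obtain ⟨c2, h2⟩ := h2
  obtain ⟨c3, h3⟩ := h3
  simp only [← Matrix.ext_iff, Fin.forall_fin_two] at h0 h1 h2 h3
  simp at h0 h1 h2 h3
  obtain ⟨⟨a1, a2⟩, a3⟩ := h0
  obtain ⟨⟨b1, b2⟩, b3, b4⟩ := h1
  obtain ⟨⟨d1, d2⟩, d3, d4⟩ := h2
  obtain ⟨⟨e1, e2⟩, e3, e4⟩ := h3
  -- The second columns of `Y * mpsMat 0` and `Y * mpsMat 1` are the first column of `Y` and minus
  -- its second column, so `Y` can be read off from `X 0` and `X 1`.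
  refine ⟨!![X 0 0 1, - X 1 0 1; X 0 1 1, - X 1 1 1], fun i => ?_⟩
  fin_cases i
  · simp only [Fin.zero_eta, mul_mpsMat_zero]
    ext i j; fin_cases i <;> fin_cases j <;> simp
    · exact a2
    · rw [a3, ← a1]
  · simp only [Fin.mk_one, mul_mpsMat_one]
    ext i j; fin_cases i <;> fin_cases j <;> simp
    · linear_combination b2
    · linear_combination b4 - b1 + a2
  · simp only [Fin.reduceFinMk, mul_mpsMat_two]
    ext i j; fin_cases i <;> fin_cases j <;> simp
    · linear_combination d2
    · exact e2
    · linear_combination e3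
    · linear_combination e1 - e4 - d2

/-- All bond conditions hold for the function `f` on words of length `m`. -/
def IsOpenLow (m : ℕ) (f : List (Fin 3) → ℂ) : Prop :=
  ∀ u v : List (Fin 3), u.length + v.length + 2 = m → IsLow fun a b => f (u ++ a :: b :: v)

lemma IsOpenLow.exists_trace {m : ℕ} (hm : 2 ≤ m) {f : List (Fin 3) → ℂ} (hf : IsOpenLow m f) :
    ∃ X : Matrix (Fin 2) (Fin 2) ℂ, ∀ w : List (Fin 3), w.length = m →
      f w = (X * mpsProd w).trace := by
  induction m, hm using Nat.le_induction generalizing f with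
  | base =>
    obtain ⟨h1, h2, h3, h4, h5⟩ := hf [] [] rfl
    simp only [List.nil_append, nsmul_eq_mul] at h1 h2 h3 h4 h5
    push_cast at h3
    -- Each of the words 02, 21, 01, 20 has a product with a single nonzero entry, so its amplitude
    -- determines one entry of `X`.
    refine ⟨!![-f [0, 2] / 2, -f [2, 1] / 2; -f [0, 1], -f [2, 0] / 2], fun w hw => ?_⟩
    obtain ⟨a, b, rfl⟩ := List.length_eq_two.1 hw
    rw [mpsProd_cons, mpsProd_cons, mpsProd_nil, mul_one]
    fin_cases a <;> fin_cases b <;>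
      simp [mpsMat_zero, mpsMat_one, mpsMat_two, Matrix.trace, Fin.sum_univ_two]
    · exact h1
    · linear_combination h2
    · linear_combination (1 / 2 : ℂ) * h3
    · linear_combination h4
    · exact h5
  | succ m hm ih =>
    have hX : ∀ i, ∃ X : Matrix (Fin 2) (Fin 2) ℂ, ∀ w : List (Fin 3), w.length = m →
        f (i :: w) = (X * mpsProd w).trace := fun i =>
      ih (f := fun w => f (i :: w)) fun u v huv => hf (i :: u) v (by simp only [List.length_cons]; omega)
    choose X hX using hX
    -- The condition on the first bond alone; the other bonds were used to obtain the matrices `X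
    -- i`.
    have hlow : ∀ v : List (Fin 3), v.length = m - 1 →
        IsLow fun a b => (X a * mpsMat b * mpsProd v).trace := by
      intro v hv
      have := hf [] v (by simp only [List.length_nil]; omega)
      simp only [List.nil_append] at this
      convert this using 3 with a b
      rw [hX a (b :: v) (by simp only [List.length_cons]; omega), mpsProd_cons, mul_assoc]
    have hm1 : 1 ≤ m - 1 := by omega
    obtain ⟨Y, hY⟩ := eq_mul_mpsMat_of_scalar (X := X)
      (eq_smul_one_of_trace_mul_mpsProd hm1 fun v hv => (hlow v hv).1)
      (eq_smul_one_of_trace_mul_mpsProd hm1 fun v hv => by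
        rw [add_mul, Matrix.trace_add]; exact (hlow v hv).2.1)
      (eq_smul_one_of_trace_mul_mpsProd hm1 fun v hv => by
        rw [add_mul, add_mul, Matrix.trace_add, Matrix.trace_add, smul_mul_assoc, Matrix.trace_smul]
        exact (hlow v hv).2.2.1)
      (eq_smul_one_of_trace_mul_mpsProd hm1 fun v hv => by
        rw [add_mul, Matrix.trace_add]; exact (hlow v hv).2.2.2.1)
    refine ⟨Y, fun w hw => ?_⟩
    match w, hw with
    | i :: w, hw => rw [hX i w (by simpa using hw), hY, mpsProd_cons, mul_assoc]

lemma eq_smul_one_of_intertwines {X Y : Matrix (Fin 2) (Fin 2) ℂ}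
    (h : ∀ a, X * mpsMat a = mpsMat a * Y) : ∃ c : ℂ, X = c • 1 := by
  have h0 := h 0
  have h1 := h 1
  have h2 := h 2
  rw [mul_mpsMat_zero] at h0
  rw [mul_mpsMat_one] at h1
  rw [mul_mpsMat_two] at h2
  simp only [mpsMat_zero, mpsMat_one, mpsMat_two, ← Matrix.ext_iff, Fin.forall_fin_two] at h0 h1 h2
  simp [Matrix.mul_apply] at h0 h1 h2
  refine ⟨X 0 0, ?_⟩
  ext i j; fin_cases i <;> fin_cases j <;> simp
  · exact h2.1
  · exact h0.2
  · rw [h1.2.2, h0.1.2]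

/-! ### Closing the chain: the common kernel of the bond projectors -/

section Ring

variable {n : ℕ} [NeZero n]

/-- The configuration of the ring read off from a word, starting at the site `c`. -/
def ofWord (c : Fin n) (w : List (Fin 3)) : Fin n → Fin 3 := fun j => w.getD (j - c).val 0

lemma ofWord_append_cons_cons (c : Fin n) (u v : List (Fin 3)) (a b : Fin 3)
    (h : u.length + v.length + 2 = n) :
    ofWord c (u ++ a :: b :: v) =
      setBond (c + ⟨u.length, by omega⟩) (ofWord c (u ++ 0 :: 0 :: v)) (a, b) := by
  have hn1 : ((1 : Fin n) : ℕ) = 1 := by rw [Fin.val_one', Nat.mod_eq_of_lt (by omega)]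
  ext1 j
  obtain ⟨i, rfl⟩ : ∃ i, j = c + i := ⟨j - c, by abel⟩
  have e : c + i - c = i := by abel
  simp only [ofWord, setBond, Function.update_apply, e, add_assoc, add_right_inj]
  have hi1 : i = ⟨u.length, by omega⟩ + 1 ↔ i.val = u.length + 1 := by
    rw [Fin.ext_iff, Fin.val_add, hn1, Nat.mod_eq_of_lt (by simp only []; omega)]
  have hi0 : i = ⟨u.length, by omega⟩ ↔ i.val = u.length := by rw [Fin.ext_iff]
  simp only [hi1, hi0]
  rcases lt_trichotomy i.val u.length with h1 | h1 | h1
  · rw [if_neg (by omega), if_neg (by omega), List.getD_append _ _ _ _ h1,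
      List.getD_append _ _ _ _ h1]
  · rw [if_neg (by omega), if_pos h1, List.getD_append_right _ _ _ _ h1.ge, h1]
    simp
  · rw [List.getD_append_right _ _ _ _ h1.le, List.getD_append_right _ _ _ _ h1.le]
    obtain ⟨d, hd⟩ := Nat.exists_eq_add_of_lt h1
    have e : i.val - u.length = d + 1 := by omega
    rw [e, if_neg (by omega : ¬ i.val = u.length)]
    cases d with
    | zero => rw [if_pos (by omega)]; simp
    | succ d => rw [if_neg (by omega)]; simp

lemma isOpenLow_ofWord (hn : 3 ≤ n) {φ : ChainVec n} (hφ : ∀ k, onBond k bondP *ᵥ φ = 0)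
    (c : Fin n) : IsOpenLow n fun w => φ (ofWord c w) := by
  intro u v huv
  have hu : u.length < n := by omega
  have := (onBond_bondP_mulVec_eq_zero_iff (add_one_ne_self hn _) φ).1
    (hφ (c + ⟨u.length, hu⟩)) (ofWord c (u ++ 0 :: 0 :: v))
  have e : (fun a b => φ (ofWord c (u ++ a :: b :: v))) = fun a b => φ (setBond
      (c + ⟨u.length, hu⟩) (ofWord c (u ++ 0 :: 0 :: v)) (a, b)) := by
    funext a b
    rw [ofWord_append_cons_cons c u v a b huv]
  rw [e]
  exact this

/-- Moving the cut of the ring by one site moves the first letter to the end; this compares the two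
open-chain forms of one vector. -/
lemma ofWord_cons (a : Fin 3) (w : List (Fin 3)) (hw : w.length + 1 = n) :
    ofWord (0 : Fin n) (a :: w) = ofWord 1 (w ++ [a]) := by
  subst hw
  ext1 j
  refine Fin.cases ?_ (fun i => ?_) j
  · have e : ((0 : Fin (w.length + 1)) - 1).val = w.length := by
      rw [zero_sub, Fin.coe_neg_one]
    simp [ofWord]
  · have e : (i.succ - 1 : Fin (w.length + 1)) = i.castSucc := by
      rw [sub_eq_iff_eq_add, Fin.coeSucc_eq_succ]
    simp only [ofWord, sub_zero, e, Fin.val_succ, Fin.val_castSucc, List.getD_cons_succ]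
    rw [List.getD_append _ _ _ _ i.2]

/-- The (unnormalised) AKLT state in matrix product form. -/
def mps (n : ℕ) : ChainVec n := fun s => (mpsProd (List.ofFn s)).trace

lemma ofWord_ofFn (s : Fin n → Fin 3) : ofWord 0 (List.ofFn s) = s := by
  ext1 j
  simp [ofWord]

lemma ofFn_ofWord (w : List (Fin 3)) (hw : w.length = n) : List.ofFn (ofWord (0 : Fin n) w) = w := by
  subst hw
  apply List.ext_getElem
  · simp
  · intro i h1 h2
    simp [ofWord, h2]

lemma eq_smul_mps (hn : 3 ≤ n) {φ : ChainVec n} (hφ : ∀ k, onBond k bondP *ᵥ φ = 0) :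
    ∃ z : ℂ, φ = z • mps n := by
  obtain ⟨X, hX⟩ := (isOpenLow_ofWord hn hφ 0).exists_trace (by omega)
  obtain ⟨Y, hY⟩ := (isOpenLow_ofWord hn hφ 1).exists_trace (by omega)
  -- Both cuts give the amplitude of the same configuration, and the remaining n - 1 ≥ 2 letters
  -- have products spanning all matrices.
  have h : ∀ a, X * mpsMat a = mpsMat a * Y := by
    intro a
    rw [← sub_eq_zero]
    refine eq_zero_of_trace_mul_mpsProd (m := n - 1) (by omega) fun w hw => ?_
    have h1 := hX (a :: w) (by simp only [List.length_cons]; omega)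
    have h2 := hY (w ++ [a]) (by simp only [List.length_append, List.length_singleton]; omega)
    rw [ofWord_cons a w (by omega), h2, mpsProd_cons, mpsProd_append, mpsProd_cons, mpsProd_nil,
      mul_one, ← mul_assoc, Matrix.trace_mul_comm, ← mul_assoc, ← mul_assoc] at h1
    rw [sub_mul, Matrix.trace_sub, h1, sub_self]
  obtain ⟨c, rfl⟩ := eq_smul_one_of_intertwines h
  refine ⟨c, ?_⟩
  ext s
  have := hX (List.ofFn s) (by simp)
  rw [ofWord_ofFn] at this
  rw [this, Pi.smul_apply, mps, smul_one_mul, Matrix.trace_smul]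

lemma mps_ne_zero (hn : 3 ≤ n) : mps n ≠ 0 := by
  intro h
  have : mpsMat 1 = 0 := by
    refine eq_zero_of_trace_mul_mpsProd (m := n - 1) (by omega) fun w hw => ?_
    have h1 := congrFun h (ofWord 0 (1 :: w))
    rw [mps, ofFn_ofWord _ (by simp only [List.length_cons]; omega), mpsProd_cons] at h1
    exact h1
  have := congrFun (congrFun this 0) 0
  simp [mpsMat_one] at this

lemma mps_add_one (s : Fin n → Fin 3) : mps n (fun i => s (i + 1)) = mps n s := by
  obtain ⟨m, rfl⟩ := Nat.exists_eq_succ_of_ne_zero (NeZero.ne n)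
  rw [mps, mps, List.ofFn_succ', List.ofFn_succ (f := s), List.concat_eq_append, mpsProd_append,
    Matrix.trace_mul_comm, mpsProd_cons, mpsProd_cons, mpsProd_nil, mul_one]
  simp

lemma mps_add (k : Fin n) (s : Fin n → Fin 3) : mps n (fun i => s (i + k)) = mps n s := by
  obtain ⟨m, rfl⟩ := Nat.exists_eq_succ_of_ne_zero (NeZero.ne n)
  induction k using Fin.induction with
  | zero => simp
  | succ i ih =>
    rw [← ih, ← mps_add_one (fun j => s (j + i.castSucc)), ← Fin.coeSucc_eq_succ]
    congr 1
    ext1 j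
    rw [add_assoc, add_comm 1]

lemma onBond_bondP_mulVec_mps (hn : 3 ≤ n) (k : Fin n) : onBond k bondP *ᵥ mps n = 0 := by
  rw [onBond_bondP_mulVec_eq_zero_iff (add_one_ne_self hn k)]
  intro s
  obtain ⟨m, rfl⟩ : ∃ m, n = m + 2 := ⟨n - 2, by omega⟩
  let W := mpsProd (List.ofFn fun i : Fin m => s (i.succ.succ + k))
  -- Translation invariance moves the bond to the first two letters, so that the rest of the word is
  -- a fixed factor `W`.
  have e : ∀ a b, mps (m + 2) (setBond k s (a, b)) = (mpsMat a * mpsMat b * W).trace := by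
    intro a b
    rw [← mps_add k, mps, List.ofFn_succ, List.ofFn_succ, mpsProd_cons, mpsProd_cons, mul_assoc]
    have hk := add_one_ne_self hn k
    have h0 : setBond k s (a, b) (0 + k) = a := by simp [setBond, hk.symm]
    have h1 : setBond k s (a, b) (Fin.succ 0 + k) = b := by simp [setBond, add_comm]
    have h2 : (fun i : Fin m => setBond k s (a, b) (i.succ.succ + k)) =
        fun i => s (i.succ.succ + k) := by
      funext i
      refine setBond_agreeOff k s (a, b) _ (by simp) ?_
      rw [add_comm k 1, Ne, add_left_inj]
      simp [Fin.ext_iff]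
    rw [h0, h1, h2]
  simp only [e]
  exact isLow_mpsMat.map
    ((Matrix.traceAddMonoidHom (Fin 2) ℂ).comp (AddMonoidHom.mulRight W))

end Ring

/-! ### Partial traces and one turn of the completely positive maps around the ring -/

section Ring

variable {n : ℕ}

/-- The partial trace over the site `j`, tensored with the identity on that site. -/
def siteTrace (j : Fin n) (X : ChainOp n) : ChainOp n :=
  Matrix.of fun s t =>
    if s j = t j then ∑ a, X (Function.update s j a) (Function.update t j a) else 0

/-- `Z` acts as the identity on the site `j`. -/
def IsTrivialAt (j : Fin n) (Z : ChainOp n) : Prop :=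
  ∀ s t, (s j ≠ t j → Z s t = 0) ∧
    (s j = t j → ∀ a, Z (Function.update s j a) (Function.update t j a) = Z s t)

lemma siteTrace_apply (j : Fin n) (X : ChainOp n) (s t : Fin n → Fin 3) :
    siteTrace j X s t =
      if s j = t j then ∑ a, X (Function.update s j a) (Function.update t j a) else 0 := rfl

lemma siteTrace_isTrivialAt (j : Fin n) (X : ChainOp n) : IsTrivialAt j (siteTrace j X) := by
  refine fun s t => ⟨fun h => by rw [siteTrace_apply, if_neg h], fun h a => ?_⟩
  simp [siteTrace_apply, h]

lemma IsTrivialAt.siteTrace {j : Fin n} {Z : ChainOp n} (h : IsTrivialAt j Z) (i : Fin n) :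
    IsTrivialAt j (siteTrace i Z) := by
  by_cases hij : j = i
  · subst hij; exact siteTrace_isTrivialAt _ _
  refine fun s t => ⟨fun hst => ?_, fun hst a => ?_⟩
  · rw [siteTrace_apply]
    split_ifs
    · exact Finset.sum_eq_zero fun a _ => (h _ _).1 (by simpa [hij] using hst)
    · rfl
  · simp only [siteTrace_apply, Function.update_of_ne (Ne.symm hij)]
    congr 1
    refine Finset.sum_congr rfl fun b _ => ?_
    rw [Function.update_comm hij, Function.update_comm hij]
    exact (h _ _).2 (by simpa [hij] using hst) a

lemma siteTrace_smul (j : Fin n) (c : ℂ) (X : ChainOp n) :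
    siteTrace j (c • X) = c • siteTrace j X := by
  ext s t
  simp only [siteTrace_apply, Matrix.smul_apply, smul_eq_mul, Finset.mul_sum, mul_ite, mul_zero]

lemma sum_sum_update {M : Type*} [AddCommMonoid M] (j : Fin n) (F : (Fin n → Fin 3) → M) :
    ∑ s, ∑ a, F (Function.update s j a) = 3 • ∑ s, F s := by
  let e : (Fin n → Fin 3) × Fin 3 → (Fin n → Fin 3) × Fin 3 :=
    -- Exchanging the spin at `j` with the extra one is an involution, so the extra sum only
    -- contributes a factor 3.
    fun x => (Function.update x.1 j x.2, x.1 j)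
  have he : Function.Involutive e := fun x => by simp [e]
  rw [← Fintype.sum_prod_type']
  rw [Fintype.sum_bijective e he.bijective _ (fun x => F x.1) (fun x => rfl),
    Fintype.sum_prod_type]
  simp [Finset.sum_nsmul]

lemma trace_siteTrace (j : Fin n) (X : ChainOp n) : (siteTrace j X).trace = 3 * X.trace := by
  simp only [Matrix.trace, Matrix.diag, siteTrace_apply, if_true]
  rw [sum_sum_update j fun s => X s s, nsmul_eq_mul]
  norm_num

lemma eq_smul_one_of_isTrivialAt {Z : ChainOp n} (h : ∀ j, IsTrivialAt j Z) :
    ∃ c : ℂ, Z = c • 1 := by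
  refine ⟨Z 0 0, ?_⟩
  ext s t
  rw [Matrix.smul_apply, Matrix.one_apply]
  split_ifs with hst
  · subst hst
    -- Diagonal entries are compared by changing the configuration 0 into `s` one site at a time.
    have key : ∀ S : Finset (Fin n), Z (S.piecewise s 0) (S.piecewise s 0) = Z 0 0 := by
      intro S
      induction S using Finset.induction_on with
      | empty => simp
      | insert j S _ ih => rw [Finset.piecewise_insert, (h j _ _).2 rfl, ih]
    have := key Finset.univ
    rw [Finset.piecewise_univ] at this
    rw [this, smul_eq_mul, mul_one]
  · obtain ⟨j, hj⟩ := Function.ne_iff.1 hst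
    rw [(h j s t).1 hj, smul_zero]

variable [NeZero n]

lemma IsTrivialAt.setBond {k : Fin n} {Z : ChainOp n} (hk : k + 1 ≠ k) (h0 : IsTrivialAt k Z)
    (h1 : IsTrivialAt (k + 1) Z) {s t : Fin n → Fin 3} (h : getBond k s = getBond k t)
    (p : Fin 3 × Fin 3) : Z (setBond k s p) (setBond k t p) = Z s t := by
  obtain ⟨e0, e1⟩ := Prod.ext_iff.1 h
  simp only [getBond] at e0 e1
  rw [AKLT.setBond, AKLT.setBond, (h1 _ _).2 (by simp [hk, e1]), (h0 _ _).2 e0]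

lemma IsTrivialAt.eq_zero {k : Fin n} {Z : ChainOp n} (h0 : IsTrivialAt k Z)
    (h1 : IsTrivialAt (k + 1) Z) {s t : Fin n → Fin 3} (h : getBond k s ≠ getBond k t) :
    Z s t = 0 := by
  by_cases e0 : s k = t k
  · exact (h1 s t).1 fun e1 => h (Prod.ext e0 e1)
  · exact (h0 s t).1 e0

/-- In each product, triviality of `Z` on the bond leaves a single term of the sum, and the two
terms agree. -/
lemma onBond_mul_comm_of_isTrivialAt {k : Fin n} (hk : k + 1 ≠ k) {Z : ChainOp n}
    (h0 : IsTrivialAt k Z) (h1 : IsTrivialAt (k + 1) Z) (A : BondOp) :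
    onBond k A * Z = Z * onBond k A := by
  ext s t
  rw [onBond_mul_apply hk, mul_onBond_apply hk, Finset.sum_eq_single (getBond k t),
    Finset.sum_eq_single (getBond k s), mul_comm]
  · congr 1
    have := IsTrivialAt.setBond hk h0 h1 (getBond_setBond hk s (getBond k t)) (getBond k s)
    rw [setBond_setBond hk, setBond_self] at this
    exact this.symm
  · intro q _ hq
    rw [IsTrivialAt.eq_zero h0 h1 (by rw [getBond_setBond hk]; exact hq.symm), zero_mul]
  · intro h; exact (h (Finset.mem_univ _)).elim
  · intro q _ hq
    rw [IsTrivialAt.eq_zero h0 h1 (by rwa [getBond_setBond hk]), mul_zero]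
  · intro h; exact (h (Finset.mem_univ _)).elim

lemma siteTrace_onBond_bondP_mul {k : Fin n} (hk : k + 1 ≠ k) {Z : ChainOp n}
    (h : IsTrivialAt (k + 1) Z) :
    siteTrace (k + 1) (onBond k bondP * Z) = (5 / 3 : ℂ) • Z := by
  ext s t
  rw [siteTrace_apply, Matrix.smul_apply]
  split_ifs with hst
  · have e : ∀ a, (onBond k bondP * Z) (Function.update s (k + 1) a) (Function.update t (k + 1) a) =
        ∑ c, bondP (s k, a) (c, a) * Z (Function.update s k c) t := by
      intro a
      rw [onBond_mul_apply hk, Fintype.sum_prod_type]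
      refine Finset.sum_congr rfl fun c _ => ?_
      have hg : getBond k (Function.update s (k + 1) a) = (s k, a) := by simp [getBond, hk.symm]
      have hs : ∀ b, setBond k (Function.update s (k + 1) a) (c, b) =
          Function.update (Function.update s k c) (k + 1) b := by
        intro b
        rw [AKLT.setBond, Function.update_comm hk, Function.update_idem]
      rw [Finset.sum_eq_single a]
      · rw [hg, hs, (h _ _).2 (by simp [hk, hst])]
      · intro b _ hb
        rw [hs, (h _ _).1 (by simpa using hb), mul_zero]
      · intro h; exact (h (Finset.mem_univ _)).elim
    simp only [e]
    rw [Finset.sum_comm]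
    simp only [← Finset.sum_mul, sum_bondP_right, ite_mul, zero_mul]
    simp
  · rw [(h s t).1 hst, smul_zero]

lemma IsTwirl.sum_onBond_conj {k : Fin n} (hk : k + 1 ≠ k) {N : ℕ} {U : Fin N → BondOp}
    (hU : IsTwirl U) (X : ChainOp n) :
    ∑ α, (onBond k (U α))ᴴ * X * onBond k (U α) =
      ((N : ℂ) / 9) • siteTrace (k + 1) (siteTrace k X) := by
  ext s t
  let M : BondOp := Matrix.of fun p q => X (setBond k s p) (setBond k t q)
  have e : ∀ α, ((onBond k (U α))ᴴ * X * onBond k (U α)) s t =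
      ((U α)ᴴ * M * U α) (getBond k s) (getBond k t) := by
    intro α
    rw [mul_onBond_apply hk, Matrix.mul_apply]
    refine Finset.sum_congr rfl fun q _ => ?_
    rw [onBond_conjTranspose, onBond_mul_apply hk, Matrix.mul_apply]
    rfl
  have e2 := congrFun (congrFun (hU.sum_conj M) (getBond k s)) (getBond k t)
  rw [Matrix.sum_apply] at e2 ⊢
  simp only [e, e2]
  rw [Matrix.smul_apply, Matrix.smul_apply, Matrix.one_apply, siteTrace_apply]
  simp only [siteTrace_apply, Function.update_of_ne hk.symm, getBond, Prod.mk.injEq]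
  by_cases h0 : s k = t k
  · by_cases h1 : s (k + 1) = t (k + 1)
    · simp only [h0, h1, and_self, if_true, smul_eq_mul, mul_one]
      congr 1
      rw [Matrix.trace, Fintype.sum_prod_type, Finset.sum_comm]
      refine Finset.sum_congr rfl fun b _ => Finset.sum_congr rfl fun a _ => ?_
      simp only [Matrix.diag, M, Matrix.of_apply, setBond]
      rw [Function.update_comm hk, Function.update_comm hk]
    · simp [h1]
  · simp [h0]

/-- The twirl replaces `X` by its partial trace over the bond. This commutes with the projectors on
both sides, which merge into one. -/
lemma cpMap_eq (hn : 3 ≤ n) {N : ℕ} {U : Fin n → Fin N → BondOp} (hU : ∀ k, IsTwirl (U k))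
    (k : Fin n) (X : ChainOp n) :
    cpMap U k X = ((N : ℂ) / 9) • (onBond k bondP * siteTrace (k + 1) (siteTrace k X)) := by
  have hk := add_one_ne_self hn k
  have e : ∀ α, (jump U (k, α))ᴴ * X * jump U (k, α) =
      onBond k bondP * ((onBond k (U k α))ᴴ * X * onBond k (U k α)) * onBond k bondP := by
    intro α
    rw [jump, Matrix.conjTranspose_mul, (onBond_bondP_isHermitian k).eq]
    simp only [mul_assoc]
  rw [cpMap]
  simp only [e]
  rw [← Finset.sum_mul, ← Finset.mul_sum, (hU k).sum_onBond_conj hk, mul_smul_comm, smul_mul_assoc,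
    mul_assoc, ← onBond_mul_comm_of_isTrivialAt hk ((siteTrace_isTrivialAt k X).siteTrace _)
      (siteTrace_isTrivialAt _ _), ← mul_assoc, onBond_bondP_mul_self hk]

lemma ofFn_eq_map_range {α : Type*} (f : Fin n → α) :
    List.ofFn f = (List.range n).map fun i => f (Fin.ofNat n i) := by
  apply List.ext_getElem
  · simp
  · intro i h1 h2
    have hi : i < n := by simpa using h1
    simp [Fin.ofNat, Nat.mod_eq_of_lt hi]

lemma ofNat_add_one (i : ℕ) : Fin.ofNat n (i + 1) = Fin.ofNat n i + 1 := by
  ext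
  simp [Fin.ofNat, Fin.val_add]

/-- After m + 1 maps the operator is a projector on the last bond times some `Z` trivial on every
site visited. The trace of `Z` is tracked so that the final constant is seen to be positive. -/
lemma foldl_cpMap (hn : 3 ≤ n) {N : ℕ} {U : Fin n → Fin N → BondOp} (hU : ∀ k, IsTwirl (U k))
    (k : Fin n) {X : ChainOp n} (hX : X.trace = 1) (m : ℕ) :
    ∃ (C d : ℝ) (Z : ChainOp n), 0 < C ∧ 0 < d ∧ Z.trace = d ∧
      (∀ i ≤ m + 1, IsTrivialAt (k + Fin.ofNat n i) Z) ∧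
      ((List.range (m + 1)).map fun i => k + Fin.ofNat n i).foldl (fun Y j => cpMap U j Y) X =
        (C : ℂ) • (onBond (k + Fin.ofNat n m) bondP * Z) := by
  have hN : (0 : ℝ) < N := by exact_mod_cast (hU k).pos
  induction m with
  | zero =>
    have h0 : Fin.ofNat n 0 = 0 := rfl
    have h1 : Fin.ofNat n 1 = 1 := rfl
    refine ⟨N / 9, 9, siteTrace (k + 1) (siteTrace k X), by positivity, by norm_num, ?_, ?_, ?_⟩
    · rw [trace_siteTrace, trace_siteTrace, hX]; norm_num
    · intro i hi
      interval_cases i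
      · rw [h0, add_zero]; exact (siteTrace_isTrivialAt k X).siteTrace _
      · rw [h1]; exact siteTrace_isTrivialAt _ _
    · simp only [zero_add, List.range_one, List.map_cons, List.map_nil, List.foldl_cons,
        List.foldl_nil, h0, add_zero]
      rw [cpMap_eq hn hU]
      push_cast
      rfl
  | succ m ih =>
    obtain ⟨C, d, Z, hC, hd, hZ, hdep, hfold⟩ := ih
    have hsite : k + Fin.ofNat n (m + 1) = k + Fin.ofNat n m + 1 := by
      rw [ofNat_add_one, add_assoc]
    have hsite2 : k + Fin.ofNat n (m + 1 + 1) = k + Fin.ofNat n (m + 1) + 1 := by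
      rw [ofNat_add_one, add_assoc]
    refine ⟨N / 9 * (C * (5 / 3)), 3 * d, siteTrace (k + Fin.ofNat n (m + 1) + 1) Z,
      by positivity, by positivity, ?_, ?_, ?_⟩
    · rw [trace_siteTrace, hZ]; push_cast; rfl
    · intro i hi
      rcases Nat.lt_or_ge i (m + 1 + 1) with hi' | hi'
      · exact (hdep i (by omega)).siteTrace _
      · have : i = m + 1 + 1 := by omega
        rw [this, hsite2]
        exact siteTrace_isTrivialAt _ _
    · rw [List.range_succ, List.map_append, List.foldl_append, hfold]
      simp only [List.map_cons, List.map_nil, List.foldl_cons, List.foldl_nil]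
      rw [cpMap_eq hn hU, siteTrace_smul]
      -- Tracing out the site shared by the old and the new bond reduces the old projector to the
      -- number 5/3.
      have e : siteTrace (k + Fin.ofNat n (m + 1)) (onBond (k + Fin.ofNat n m) bondP * Z) =
          (5 / 3 : ℂ) • Z := by
        have hd := hdep (m + 1) le_rfl
        rw [hsite] at hd ⊢
        exact siteTrace_onBond_bondP_mul (add_one_ne_self hn _) hd
      rw [e, smul_smul, siteTrace_smul, mul_smul_comm, smul_smul]
      push_cast
      rfl

lemma exists_sweep_eq (hn : 3 ≤ n) {N : ℕ} {U : Fin n → Fin N → BondOp}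
    (hU : ∀ k, IsTwirl (U k)) (k : Fin n) {X : ChainOp n} (hX : X.trace = 1) :
    ∃ C : ℝ, 0 < C ∧ sweep U k X = (C : ℂ) • onBond k bondP := by
  -- The n maps start at bond k + 1 and end at bond k, by which time `Z` is trivial on every site,
  -- hence scalar.
  obtain ⟨C, d, Z, hC, hd, hZ, hdep, hfold⟩ := foldl_cpMap hn hU (k + 1) hX (n - 1)
  have hlast : k + 1 + Fin.ofNat n (n - 1) = k := by
    have h1 := ofNat_add_one (n := n) (n - 1)
    rw [Nat.sub_add_cancel (by omega)] at h1
    have h2 : Fin.ofNat n n = 0 := by ext; simp [Fin.ofNat]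
    rw [add_assoc, add_comm 1, ← h1, h2, add_zero]
  have hall : ∀ j, IsTrivialAt j Z := by
    intro j
    have h := hdep (j - (k + 1)).val (by have := (j - (k + 1)).2; omega)
    have e : Fin.ofNat n (j - (k + 1)).val = j - (k + 1) := by simp
    rwa [e, add_sub_cancel] at h
  obtain ⟨c, rfl⟩ := eq_smul_one_of_isTrivialAt hall
  rw [hlast, Nat.sub_add_cancel (by omega)] at hfold
  rw [Matrix.trace_smul, Matrix.trace_one, smul_eq_mul] at hZ
  have hcard : (0 : ℝ) < Fintype.card (Fin n → Fin 3) := by exact_mod_cast Fintype.card_pos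
  have hc : c = ((d / Fintype.card (Fin n → Fin 3) : ℝ) : ℂ) := by
    push_cast
    rw [eq_div_iff (by exact_mod_cast hcard.ne'), hZ]
  refine ⟨C * (d / Fintype.card (Fin n → Fin 3)), by positivity, ?_⟩
  rw [sweep, ofFn_eq_map_range, hfold, mul_smul_comm, mul_one, smul_smul, Complex.ofReal_mul, hc]

end Ring

/-! ### Kernels of stationary states of a purely dissipative master equation -/

lemma proj_isHermitian {ι : Type*} (ψ : ι → ℂ) : (proj ψ)ᴴ = proj ψ := by
  rw [proj, Matrix.conjTranspose_vecMulVec, star_star]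

section General

variable {ι : Type*} [Fintype ι]

lemma mul_proj (A : Matrix ι ι ℂ) (ψ : ι → ℂ) :
    A * proj ψ = Matrix.vecMulVec (A *ᵥ ψ) (star ψ) := by
  rw [proj, Matrix.mul_vecMulVec]

lemma mul_proj_eq_zero {A : Matrix ι ι ℂ} {ψ : ι → ℂ} (h : A *ᵥ ψ = 0) : A * proj ψ = 0 := by
  rw [mul_proj, h]
  ext; simp [Matrix.vecMulVec_apply]

lemma proj_mulVec (ψ v : ι → ℂ) : proj ψ *ᵥ v = (star ψ ⬝ᵥ v) • ψ := by
  ext i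
  rw [proj, Matrix.vecMulVec_mulVec]
  simp [mul_comm]

lemma trace_proj {ψ : ι → ℂ} (h : IsUnit ψ) : (proj ψ).trace = 1 := by
  rw [proj, Matrix.trace_vecMulVec, dotProduct_comm]
  exact h

lemma IsUnit.ne_zero {ψ : ι → ℂ} (h : IsUnit ψ) : ψ ≠ 0 := by
  rintro rfl
  simp [IsUnit] at h

lemma proj_posSemidef (ψ : ι → ℂ) : (proj ψ).PosSemidef :=
  Matrix.posSemidef_vecMulVec_self_star ψ

lemma eq_proj_of_forall_mulVec {ρ : Matrix ι ι ℂ} (hρ : IsDensity ρ) {ψ : ι → ℂ} (hψ : IsUnit ψ)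
    (h : ∀ v, ∃ z : ℂ, ρ *ᵥ v = z • ψ) : ρ = proj ψ := by
  classical
  have h1 : proj ψ * ρ = ρ := by
    refine Matrix.ext_of_mulVec_single fun i => ?_
    obtain ⟨z, hz⟩ := h (Pi.single i 1)
    have hψ' : star ψ ⬝ᵥ ψ = 1 := hψ
    rw [← Matrix.mulVec_mulVec, hz, Matrix.mulVec_smul, proj_mulVec, hψ', one_smul]
  have h2 : ρ * proj ψ = ρ := by
    have := congrArg Matrix.conjTranspose h1
    rwa [Matrix.conjTranspose_mul, proj_isHermitian, hρ.1.isHermitian.eq] at this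
  obtain ⟨z, hz⟩ := h ψ
  have h3 : ρ = z • proj ψ := by
    rw [← h2, mul_proj, hz, Matrix.smul_vecMulVec, proj]
  have h4 := hρ.2
  rw [h3, Matrix.trace_smul, trace_proj hψ, smul_eq_mul, mul_one] at h4
  rw [h3, h4, one_smul]

variable {κ : Type*} [Fintype κ] {g : κ → ℝ} {c : κ → Matrix ι ι ℂ} {ρ : Matrix ι ι ℂ}

lemma lindblad_proj_eq_zero {ψ : ι → ℂ} (h : ∀ l, c l *ᵥ ψ = 0) :
    lindblad 0 g c (proj ψ) = 0 := by
  have h1 : ∀ l, c l * proj ψ = 0 := fun l => mul_proj_eq_zero (h l)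
  have h2 : ∀ l, proj ψ * (c l)ᴴ = 0 := fun l => by
    have := congrArg Matrix.conjTranspose (h1 l)
    rwa [Matrix.conjTranspose_mul, proj_isHermitian, Matrix.conjTranspose_zero] at this
  simp [lindblad, h1, mul_assoc, ← mul_assoc (proj ψ), h2]

/-- In ⟨v, L(ρ)v⟩ = 0 either assumption on `v` removes both anticommutator terms. The nonnegative
remaining terms then vanish one by one, and positivity of ρ turns ⟨w, ρw⟩ = 0 into ρw = 0. -/
lemma mulVec_conjTranspose_eq_zero (hρ : ρ.PosSemidef) (hg : ∀ l, 0 < g l)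
    (hL : lindblad 0 g c ρ = 0) {v : ι → ℂ} (hv : ρ *ᵥ v = 0 ∨ ∀ l, c l *ᵥ v = 0) (l : κ) :
    ρ *ᵥ ((c l)ᴴ *ᵥ v) = 0 := by
  have hρ' := hρ.isHermitian.eq
  have h1 : ∀ l, star v ⬝ᵥ (((c l)ᴴ * c l * ρ) *ᵥ v) = 0 := by
    intro l
    rcases hv with hv | hv
    · rw [← Matrix.mulVec_mulVec, hv, Matrix.mulVec_zero, dotProduct_zero]
    · rw [mul_assoc, ← Matrix.mulVec_mulVec, Matrix.dotProduct_mulVec, ← Matrix.star_mulVec, hv,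
        star_zero, zero_dotProduct]
  have h2 : ∀ l, star v ⬝ᵥ ((ρ * ((c l)ᴴ * c l)) *ᵥ v) = 0 := by
    intro l
    rcases hv with hv | hv
    · rw [← Matrix.mulVec_mulVec, Matrix.dotProduct_mulVec, ← hρ', ← Matrix.star_mulVec, hv,
        star_zero, zero_dotProduct]
    · rw [← mul_assoc, ← Matrix.mulVec_mulVec, hv, Matrix.mulVec_zero, dotProduct_zero]
  have h3 : ∀ l, star v ⬝ᵥ ((c l * ρ * (c l)ᴴ) *ᵥ v) =
      star ((c l)ᴴ *ᵥ v) ⬝ᵥ (ρ *ᵥ ((c l)ᴴ *ᵥ v)) := by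
    intro l
    rw [mul_assoc, ← Matrix.mulVec_mulVec, Matrix.dotProduct_mulVec, Matrix.star_mulVec,
      Matrix.conjTranspose_conjTranspose, Matrix.mulVec_mulVec]
  have h4 : ∑ l, (g l : ℂ) * (2 * (star ((c l)ᴴ *ᵥ v) ⬝ᵥ (ρ *ᵥ ((c l)ᴴ *ᵥ v)))) = 0 := by
    have h5 : star v ⬝ᵥ (lindblad 0 g c ρ *ᵥ v) = 0 := by
      rw [hL, Matrix.zero_mulVec, dotProduct_zero]
    rw [lindblad, zero_mul, mul_zero, sub_zero, smul_zero, zero_add, Matrix.sum_mulVec,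
      dotProduct_sum] at h5
    rw [← h5]
    refine Finset.sum_congr rfl fun l _ => ?_
    rw [Matrix.smul_mulVec, Matrix.sub_mulVec, Matrix.sub_mulVec, Matrix.smul_mulVec,
      dotProduct_smul, dotProduct_sub, dotProduct_sub, dotProduct_smul, h1, h2, h3]
    simp
  have hnn : ∀ l, 0 ≤ (g l : ℂ) * (2 * (star ((c l)ᴴ *ᵥ v) ⬝ᵥ (ρ *ᵥ ((c l)ᴴ *ᵥ v)))) := by
    intro l
    refine mul_nonneg (by exact_mod_cast (hg l).le) (mul_nonneg zero_le_two ?_)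
    exact hρ.dotProduct_mulVec_nonneg _
  have h6 := (Finset.sum_eq_zero_iff_of_nonneg fun l _ => hnn l).1 h4 l (Finset.mem_univ l)
  have hg' : (g l : ℂ) ≠ 0 := by exact_mod_cast (hg l).ne'
  rw [← hρ.dotProduct_mulVec_zero_iff]
  simpa [hg'] using h6

lemma mul_conjTranspose_mul_eq_zero (hρ : ρ.PosSemidef) (hg : ∀ l, 0 < g l)
    (hL : lindblad 0 g c ρ = 0) {Y : Matrix ι ι ℂ} (hY : ρ * Y = 0) (l : κ) :
    ρ * ((c l)ᴴ * Y * c l) = 0 := by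
  classical
  have h : ρ * ((c l)ᴴ * Y) = 0 := by
    refine Matrix.ext_of_mulVec_single fun i => ?_
    rw [← Matrix.mulVec_mulVec, ← Matrix.mulVec_mulVec, Matrix.zero_mulVec]
    refine mulVec_conjTranspose_eq_zero hρ hg hL (Or.inl ?_) l
    rw [Matrix.mulVec_mulVec, hY, Matrix.zero_mulVec]
  rw [← mul_assoc, h, zero_mul]

lemma mul_conjTranspose_mul_proj_eq_zero (hρ : ρ.PosSemidef) (hg : ∀ l, 0 < g l)
    (hL : lindblad 0 g c ρ = 0) {ψ : ι → ℂ} (hψ : ∀ l, c l *ᵥ ψ = 0) (l : κ) :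
    ρ * ((c l)ᴴ * proj ψ * c l) = 0 := by
  have h := mulVec_conjTranspose_eq_zero hρ hg hL (Or.inr hψ) l
  rw [← mul_assoc, ← mul_assoc, mul_proj_eq_zero (by rw [← Matrix.mulVec_mulVec, h]), zero_mul]

/-- The kernel of |φ⟩⟨φ| is the orthogonal complement of φ and is stable under every c†, so every c
preserves the line of φ. Concretely, the component χ of cφ orthogonal to φ satisfies 0 = ⟨cφ, χ⟩ =
‖χ‖². -/
lemma mulVec_eq_smul_of_lindblad_proj (hg : ∀ l, 0 < g l) {φ : ι → ℂ} (hφ : IsUnit φ)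
    (hL : lindblad 0 g c (proj φ) = 0) (l : κ) : ∃ μ : ℂ, c l *ᵥ φ = μ • φ := by
  have hφ' : star φ ⬝ᵥ φ = 1 := hφ
  refine ⟨star φ ⬝ᵥ (c l *ᵥ φ), ?_⟩
  set μ := star φ ⬝ᵥ (c l *ᵥ φ)
  set χ := c l *ᵥ φ - μ • φ with hχ
  have h0 : star φ ⬝ᵥ χ = 0 := by
    rw [hχ, dotProduct_sub, dotProduct_smul, hφ', smul_eq_mul, mul_one, sub_self]
  have h1 := mulVec_conjTranspose_eq_zero (proj_posSemidef φ) hg hL (v := χ)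
    (Or.inl (by rw [proj_mulVec, h0, zero_smul])) l
  rw [proj_mulVec] at h1
  have h2 := (smul_eq_zero.1 h1).resolve_right hφ.ne_zero
  rw [Matrix.dotProduct_mulVec, ← Matrix.star_mulVec] at h2
  have h3 : star χ ⬝ᵥ χ = 0 := by
    have e : star χ = star (c l *ᵥ φ) - star μ • star φ := by rw [hχ, star_sub, star_smul]
    rw [e, sub_dotProduct, h2, smul_dotProduct, h0, smul_zero, sub_zero]
  rw [dotProduct_star_self_eq_zero] at h3
  exact sub_eq_zero.1 h3

end General

lemma proj_smul {ι : Type*} {z : ℂ} (hz : ‖z‖ = 1) (ψ : ι → ℂ) : proj (z • ψ) = proj ψ := by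
  rw [proj, proj, star_smul, Matrix.smul_vecMulVec, Matrix.vecMulVec_smul, smul_smul,
    Complex.star_def, Complex.mul_conj', hz]
  simp

/-! ### Norms, and eigenvectors of nilpotent operators -/

section General

variable {ι : Type*} [Fintype ι]

/-- The squared norm of a vector. -/
def normSq (v : ι → ℂ) : ℝ := ∑ i, ‖v i‖ ^ 2

lemma star_dotProduct_self (v : ι → ℂ) : star v ⬝ᵥ v = (normSq v : ℂ) := by
  simp only [dotProduct, normSq, Pi.star_apply, Complex.ofReal_sum, Complex.star_def]
  refine Finset.sum_congr rfl fun i _ => ?_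
  rw [Complex.conj_mul']
  push_cast
  rfl

lemma normSq_nonneg (v : ι → ℂ) : 0 ≤ normSq v := Finset.sum_nonneg fun _ _ => by positivity

lemma normSq_eq_zero {v : ι → ℂ} : normSq v = 0 ↔ v = 0 := by
  rw [← dotProduct_star_self_eq_zero, star_dotProduct_self, Complex.ofReal_eq_zero]

lemma normSq_pos {v : ι → ℂ} (hv : v ≠ 0) : 0 < normSq v :=
  (normSq_nonneg v).lt_of_ne fun h => hv (normSq_eq_zero.1 h.symm)

lemma normSq_smul (z : ℂ) (v : ι → ℂ) : normSq (z • v) = ‖z‖ ^ 2 * normSq v := by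
  simp only [normSq, Pi.smul_apply, smul_eq_mul, norm_mul, mul_pow, Finset.mul_sum]

lemma isUnit_iff_normSq {v : ι → ℂ} : IsUnit v ↔ normSq v = 1 := by
  rw [IsUnit, star_dotProduct_self, Complex.ofReal_eq_one]

lemma exists_isUnit_smul {v : ι → ℂ} (hv : v ≠ 0) : ∃ z : ℂ, z ≠ 0 ∧ IsUnit (z • v) := by
  have h := normSq_pos hv
  refine ⟨((1 / √(normSq v) : ℝ) : ℂ), ?_, ?_⟩
  · rw [Ne, Complex.ofReal_eq_zero]
    positivity
  · rw [isUnit_iff_normSq, normSq_smul, Complex.norm_real, Real.norm_eq_abs, sq_abs, div_pow,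
      Real.sq_sqrt h.le]
    field_simp

lemma norm_eq_one_of_isUnit_smul {Ψ : ι → ℂ} (hu : IsUnit Ψ) {z : ℂ} (h : IsUnit (z • Ψ)) : ‖z‖ = 1 := by
  rw [isUnit_iff_normSq] at hu h
  rw [normSq_smul, hu, mul_one] at h
  exact (pow_eq_one_iff_of_nonneg (norm_nonneg z) two_ne_zero).1 h

lemma mulVec_eq_zero_of_nilpotent {A : Matrix ι ι ℂ} (hA : A * A * A = 0) {v : ι → ℂ} {μ : ℂ}
    (h : A *ᵥ v = μ • v) : A *ᵥ v = 0 := by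
  have h3 : μ • μ • μ • v = 0 := by
    have e : (A * A * A) *ᵥ v = 0 := by rw [hA, Matrix.zero_mulVec]
    rw [← e]
    simp only [← Matrix.mulVec_mulVec, h, Matrix.mulVec_smul]
  simp only [smul_eq_zero, or_self_left] at h3
  rcases h3 with h3 | h3
  · rw [h, h3, zero_smul]
  · rw [h3, Matrix.mulVec_zero]

end General

/-! ### The single nilpotent jump operator of a bond -/

section Ladder

variable {Φ : Fin 5 → Fin 3 × Fin 3 → ℂ} {Ψ : Fin 4 → Fin 3 × Fin 3 → ℂ}

lemma vecMulVec_mulVec_star (a b v : Fin 3 × Fin 3 → ℂ) :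
    Matrix.vecMulVec a (star b) *ᵥ v = (star b ⬝ᵥ v) • a := by
  ext i
  rw [Matrix.vecMulVec_mulVec]
  simp [mul_comm]

lemma ladder_mulVec (v : Fin 3 × Fin 3 → ℂ) :
    ladder Φ Ψ *ᵥ v = ∑ i : Fin 4, (star (Φ i.castSucc) ⬝ᵥ v) • Ψ i + (star (Φ 4) ⬝ᵥ v) • Φ 3 := by
  rw [ladder, Matrix.add_mulVec, Matrix.sum_mulVec]
  simp only [vecMulVec_mulVec_star]

lemma IsEigenbasis.bondP_mulVec_left (h : IsEigenbasis Φ Ψ) (i : Fin 5) : bondP *ᵥ Φ i = Φ i :=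
  (bondP_mulVec_eq_self_iff _).2 (h.2.2.1 i)

lemma IsEigenbasis.bondP_mulVec_right (h : IsEigenbasis Φ Ψ) (i : Fin 4) : bondP *ᵥ Ψ i = 0 :=
  (bondP_mulVec_eq_zero_iff _).2 (h.2.2.2 i)

lemma IsEigenbasis.left_dotProduct_right (h : IsEigenbasis Φ Ψ) (i : Fin 5) (j : Fin 4) :
    star (Φ i) ⬝ᵥ Ψ j = 0 := by
  rw [← h.bondP_mulVec_left i, Matrix.star_mulVec, bondP_isHermitian.eq, ← Matrix.dotProduct_mulVec,
    h.bondP_mulVec_right, dotProduct_zero]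

lemma IsEigenbasis.left_dotProduct_ladder (h : IsEigenbasis Φ Ψ) (i : Fin 5)
    (v : Fin 3 × Fin 3 → ℂ) :
    star (Φ i) ⬝ᵥ (ladder Φ Ψ *ᵥ v) = if i = 3 then star (Φ 4) ⬝ᵥ v else 0 := by
  rw [ladder_mulVec, dotProduct_add, dotProduct_sum, dotProduct_smul, h.1 i 3]
  simp only [dotProduct_smul, h.left_dotProduct_right, Finset.sum_const_zero, zero_add,
    smul_eq_mul, mul_ite, mul_one, mul_zero]

/-- The longest chain is `Φ 4` ↦ `Φ 3` ↦ `Ψ 3` ↦ 0. -/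
lemma IsEigenbasis.ladder_nilpotent (h : IsEigenbasis Φ Ψ) :
    ladder Φ Ψ * ladder Φ Ψ * ladder Φ Ψ = 0 := by
  have e : ∀ v, ladder Φ Ψ *ᵥ (ladder Φ Ψ *ᵥ (ladder Φ Ψ *ᵥ v)) = 0 := by
    intro v
    rw [ladder_mulVec]
    simp only [h.left_dotProduct_ladder]
    simp
  refine Matrix.ext_of_mulVec_single fun i => ?_
  rw [← Matrix.mulVec_mulVec, ← Matrix.mulVec_mulVec, Matrix.zero_mulVec, e]

/-- The columns of the matrix are the vectors `Φ i` and `Ψ i`. -/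
def basisMat (Φ : Fin 5 → Fin 3 × Fin 3 → ℂ) (Ψ : Fin 4 → Fin 3 × Fin 3 → ℂ) :
    Matrix (Fin 3 × Fin 3) (Fin 5 ⊕ Fin 4) ℂ := Matrix.of fun p x => Sum.elim Φ Ψ x p

/-- The permutation of the basis vectors by which the unitary part of `ladder` acts. -/
def ladderPerm : Fin 5 ⊕ Fin 4 → Fin 5 ⊕ Fin 4 :=
  Sum.elim ![.inr 0, .inr 1, .inr 2, .inr 3, .inl 3] ![.inl 0, .inl 1, .inl 2, .inl 4]

lemma ladderPerm_injective : Function.Injective ladderPerm := by decide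

lemma IsEigenbasis.basisMat_conjTranspose_mul (h : IsEigenbasis Φ Ψ) :
    (basisMat Φ Ψ)ᴴ * basisMat Φ Ψ = 1 := by
  have h' : ∀ i j, star (Ψ j) ⬝ᵥ Φ i = 0 := fun i j => by
    have := congrArg star (h.left_dotProduct_right i j)
    rwa [Matrix.star_dotProduct, star_star, star_zero] at this
  have e : ∀ x y, ((basisMat Φ Ψ)ᴴ * basisMat Φ Ψ) x y =
      star (Sum.elim Φ Ψ x) ⬝ᵥ Sum.elim Φ Ψ y := fun x y => rfl
  ext x y
  rw [e, Matrix.one_apply]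
  rcases x with i | i <;> rcases y with j | j
  · simp [h.1]
  · simp [h.left_dotProduct_right]
  · simp [h']
  · simp [h.2.1]

/-- The unitary part of `ladder`. -/
def ladderUnitary (Φ : Fin 5 → Fin 3 × Fin 3 → ℂ) (Ψ : Fin 4 → Fin 3 × Fin 3 → ℂ) : BondOp :=
  (basisMat Φ Ψ).submatrix id ladderPerm * (basisMat Φ Ψ)ᴴ

lemma IsEigenbasis.ladderUnitary_mem (h : IsEigenbasis Φ Ψ) :
    ladderUnitary Φ Ψ ∈ Matrix.unitaryGroup (Fin 3 × Fin 3) ℂ := by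
  have h1 := h.basisMat_conjTranspose_mul
  have e : Fin 5 ⊕ Fin 4 ≃ Fin 3 × Fin 3 := Fintype.equivOfCardEq (by simp)
  have h2 : basisMat Φ Ψ * (basisMat Φ Ψ)ᴴ = 1 := (Matrix.mul_eq_one_comm_of_equiv e).1 h1
  have h3 : ((basisMat Φ Ψ).submatrix id ladderPerm)ᴴ * (basisMat Φ Ψ).submatrix id ladderPerm
      = 1 := by
    rw [Matrix.conjTranspose_submatrix, ← Matrix.submatrix_mul _ _ _ _ _ Function.bijective_id, h1,
      Matrix.submatrix_one _ ladderPerm_injective]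
  rw [Matrix.mem_unitaryGroup_iff', Matrix.star_eq_conjTranspose, ladderUnitary,
    Matrix.conjTranspose_mul, Matrix.conjTranspose_conjTranspose, Matrix.mul_assoc,
    ← Matrix.mul_assoc _ _ (basisMat Φ Ψ)ᴴ, h3, Matrix.one_mul, h2]

/-- The range of `ladder` is spanned by the `Ψ i` and `Φ 3`, so the completion sends the `Ψ i` to
the unused `Φ 0`, `Φ 1`, `Φ 2`, `Φ 4`. -/
lemma ladderUnitary_eq : ladderUnitary Φ Ψ = ladder Φ Ψ +
    ∑ i : Fin 4, Matrix.vecMulVec (Φ (![0, 1, 2, 4] i)) (star (Ψ i)) := by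
  ext p q
  simp [ladderUnitary, ladder, Matrix.mul_apply, basisMat, ladderPerm, Fin.sum_univ_five,
    Fin.sum_univ_four, Matrix.vecMulVec_apply, Matrix.add_apply]

lemma vecMulVec_star_mul_bondP (a b : Fin 3 × Fin 3 → ℂ) :
    Matrix.vecMulVec a (star b) * bondP = Matrix.vecMulVec a (star (bondP *ᵥ b)) := by
  rw [Matrix.vecMulVec_mul, Matrix.star_mulVec, bondP_isHermitian.eq]

lemma IsEigenbasis.ladder_eq (h : IsEigenbasis Φ Ψ) :
    ladder Φ Ψ = ladderUnitary Φ Ψ * bondP := by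
  rw [ladderUnitary_eq, ladder, add_mul, add_mul, Finset.sum_mul, Finset.sum_mul]
  simp only [vecMulVec_star_mul_bondP, h.bondP_mulVec_left, h.bondP_mulVec_right, star_zero,
    Matrix.vecMulVec_zero, Finset.sum_const_zero, add_zero]

lemma mulVec_eq_zero_iff_of_unitary {V : BondOp}
    (hV : V ∈ Matrix.unitaryGroup (Fin 3 × Fin 3) ℂ) (v : Fin 3 × Fin 3 → ℂ) :
    (V * bondP) *ᵥ v = 0 ↔ bondP *ᵥ v = 0 := by
  rw [← Matrix.mulVec_mulVec]
  constructor
  · intro h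
    have h2 := congrArg (fun v => star V *ᵥ v) h
    simp only [Matrix.mulVec_mulVec, Matrix.mulVec_zero] at h2
    rwa [← mul_assoc, Matrix.mem_unitaryGroup_iff'.1 hV, one_mul] at h2
  · intro h; rw [h, Matrix.mulVec_zero]

lemma IsEigenbasis.ladder_eigenvector_iff (h : IsEigenbasis Φ Ψ) (v : Fin 3 × Fin 3 → ℂ) :
    (∃ μ : ℂ, ladder Φ Ψ *ᵥ v = μ • v) ↔ bondH *ᵥ v = (-2 / 3 : ℂ) • v := by
  rw [← bondP_mulVec_eq_zero_iff, ← mulVec_eq_zero_iff_of_unitary h.ladderUnitary_mem,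
    ← h.ladder_eq]
  exact ⟨fun ⟨μ, hμ⟩ => mulVec_eq_zero_of_nilpotent h.ladder_nilpotent hμ,
    fun h0 => ⟨0, by rw [h0, zero_smul]⟩⟩

variable {n : ℕ} [NeZero n]

lemma IsEigenbasis.onBond_ladder_mulVec_eq_zero_iff (h : IsEigenbasis Φ Ψ) {k : Fin n}
    (hk : k + 1 ≠ k) (φ : ChainVec n) :
    onBond k (ladder Φ Ψ) *ᵥ φ = 0 ↔ onBond k bondP *ᵥ φ = 0 := by
  rw [h.ladder_eq, onBond_mul hk, onBond_mulVec_eq_zero_of_unitary hk h.ladderUnitary_mem]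

lemma IsEigenbasis.onBond_ladder_nilpotent (h : IsEigenbasis Φ Ψ) {k : Fin n} (hk : k + 1 ≠ k) :
    onBond k (ladder Φ Ψ) * onBond k (ladder Φ Ψ) * onBond k (ladder Φ Ψ) = 0 := by
  rw [← onBond_mul hk, ← onBond_mul hk, h.ladder_nilpotent, onBond_zero]

end Ladder

/-! ### Ground states, dark states and uniqueness of the stationary state -/

section Ring

variable {n : ℕ} [NeZero n]

lemma hamiltonian_mulVec (φ : ChainVec n) :
    hamiltonian n *ᵥ φ =
      (2 : ℂ) • ∑ k, onBond k bondP *ᵥ φ - ((2 * n / 3 : ℝ) : ℂ) • φ := by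
  rw [hamiltonian, Matrix.sum_mulVec]
  simp only [onBond_bondH, Matrix.sub_mulVec, Matrix.smul_mulVec, Matrix.one_mulVec]
  rw [Finset.sum_sub_distrib, ← Finset.smul_sum, Finset.sum_const, Finset.card_univ,
    Fintype.card_fin, ← Nat.cast_smul_eq_nsmul ℂ, smul_smul]
  congr 2
  push_cast
  ring

lemma normSq_onBond_bondP {k : Fin n} (hk : k + 1 ≠ k) (φ : ChainVec n) :
    star φ ⬝ᵥ (onBond k bondP *ᵥ φ) = (normSq (onBond k bondP *ᵥ φ) : ℂ) := by
  rw [← star_dotProduct_self, Matrix.star_mulVec, (onBond_bondP_isHermitian k).eq,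
    ← Matrix.dotProduct_mulVec, Matrix.mulVec_mulVec, onBond_bondP_mul_self hk]

lemma energy_eq (hn : 3 ≤ n) {φ : ChainVec n} {E : ℝ} (h : hamiltonian n *ᵥ φ = (E : ℂ) • φ) :
    (E + 2 * n / 3) * normSq φ = 2 * ∑ k, normSq (onBond k bondP *ᵥ φ) := by
  have h1 := congrArg (fun v => star φ ⬝ᵥ v) h
  simp only [hamiltonian_mulVec, dotProduct_sub, dotProduct_smul, dotProduct_sum,
    normSq_onBond_bondP (add_one_ne_self hn _), star_dotProduct_self, smul_eq_mul] at h1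
  have h2 : (2 : ℝ) * ∑ k, normSq (onBond k bondP *ᵥ φ) - 2 * n / 3 * normSq φ = E * normSq φ := by
    exact_mod_cast h1
  linarith

lemma onBond_bondH_mulVec_iff (k : Fin n) (φ : ChainVec n) :
    onBond k bondH *ᵥ φ = (-2 / 3 : ℂ) • φ ↔ onBond k bondP *ᵥ φ = 0 := by
  rw [onBond_bondH, Matrix.sub_mulVec, Matrix.smul_mulVec, Matrix.smul_mulVec, Matrix.one_mulVec]
  constructor
  · intro h
    have : (2 : ℂ) • (onBond k bondP *ᵥ φ) = (2 : ℂ) • 0 := by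
      rw [sub_eq_iff_eq_add] at h; rw [h]; module
    exact (smul_right_injective _ two_ne_zero) this
  · intro h; rw [h]; module

lemma exists_unit_ker (hn : 3 ≤ n) : ∃ Ψ : ChainVec n, IsUnit Ψ ∧
    ∀ φ : ChainVec n, (∀ k, onBond k bondP *ᵥ φ = 0) ↔ ∃ z : ℂ, φ = z • Ψ := by
  obtain ⟨z, hz, hu⟩ := exists_isUnit_smul (mps_ne_zero hn)
  refine ⟨z • mps n, hu, fun φ => ⟨fun h => ?_, ?_⟩⟩
  · obtain ⟨w, rfl⟩ := eq_smul_mps hn h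
    exact ⟨w / z, by rw [smul_smul, div_mul_cancel₀ _ hz]⟩
  · rintro ⟨w, rfl⟩ k
    rw [Matrix.mulVec_smul, Matrix.mulVec_smul, onBond_bondP_mulVec_mps hn, smul_zero, smul_zero]

variable {Ψ : ChainVec n}

lemma hamiltonian_mulVec_of_ker {φ : ChainVec n} (h : ∀ k, onBond k bondP *ᵥ φ = 0) :
    hamiltonian n *ᵥ φ = ((-(2 * n / 3) : ℝ) : ℂ) • φ := by
  rw [hamiltonian_mulVec]
  simp only [h, Finset.sum_const_zero, smul_zero, zero_sub]
  rw [Complex.ofReal_neg, neg_smul]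

lemma isGroundState_of_ker (hn : 3 ≤ n) (hu : IsUnit Ψ) (h : ∀ k, onBond k bondP *ᵥ Ψ = 0) :
    IsGroundState (hamiltonian n) Ψ := by
  refine ⟨hu, _, hamiltonian_mulVec_of_ker h, fun E' φ hφ hE => ?_⟩
  have h1 := energy_eq hn hE
  have h2 : 0 ≤ 2 * ∑ k, normSq (onBond k bondP *ᵥ φ) :=
    mul_nonneg zero_le_two (Finset.sum_nonneg fun _ _ => normSq_nonneg _)
  rw [← h1] at h2
  have := nonneg_of_mul_nonneg_left h2 (normSq_pos hφ)
  linarith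

lemma IsGroundState.mem_ker (hn : 3 ≤ n) (hu : IsUnit Ψ) (h : ∀ k, onBond k bondP *ᵥ Ψ = 0)
    {φ : ChainVec n} (hφ : IsGroundState (hamiltonian n) φ) (k : Fin n) :
    onBond k bondP *ᵥ φ = 0 := by
  obtain ⟨_, E, hE, hmin⟩ := hφ
  have h1 := energy_eq hn hE
  have h2 := hmin _ Ψ hu.ne_zero (hamiltonian_mulVec_of_ker h)
  have h3 : (E + 2 * n / 3) * normSq φ ≤ 0 :=
    mul_nonpos_of_nonpos_of_nonneg (by linarith) (normSq_nonneg φ)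
  have h4 : ∑ k, normSq (onBond k bondP *ᵥ φ) = 0 :=
    le_antisymm (by linarith) (Finset.sum_nonneg fun _ _ => normSq_nonneg _)
  exact normSq_eq_zero.1
    ((Finset.sum_eq_zero_iff_of_nonneg fun _ _ => normSq_nonneg _).1 h4 k (Finset.mem_univ k))

lemma jump_mulVec_eq_zero_iff (hn : 3 ≤ n) {N : ℕ} {U : Fin n → Fin N → BondOp}
    (hU : ∀ k, IsTwirl (U k)) (φ : ChainVec n) :
    (∀ l, jump U l *ᵥ φ = 0) ↔ ∀ k, onBond k bondP *ᵥ φ = 0 := by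
  have e : ∀ l : Fin n × Fin N, jump U l *ᵥ φ = 0 ↔ onBond l.1 bondP *ᵥ φ = 0 := fun l =>
    onBond_mulVec_eq_zero_of_unitary (add_one_ne_self hn _) ((hU l.1).1 l.2) φ
  simp only [e]
  exact ⟨fun h k => h (k, ⟨0, (hU k).pos⟩), fun h l => h l.1⟩

lemma mul_cpMap_eq_zero {N : ℕ} {U : Fin n → Fin N → BondOp} {g : Fin n × Fin N → ℝ}
    (hg : ∀ l, 0 < g l) {ρ : ChainOp n} (hρ : ρ.PosSemidef) (hL : lindblad 0 g (jump U) ρ = 0)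
    (k : Fin n) {Y : ChainOp n} (hY : ρ * Y = 0) : ρ * cpMap U k Y = 0 := by
  rw [cpMap, Finset.mul_sum]
  exact Finset.sum_eq_zero fun α _ => mul_conjTranspose_mul_eq_zero hρ hg hL hY (k, α)

lemma mul_foldl_cpMap_eq_zero {N : ℕ} {U : Fin n → Fin N → BondOp} {g : Fin n × Fin N → ℝ}
    (hg : ∀ l, 0 < g l) {ρ : ChainOp n} (hρ : ρ.PosSemidef) (hL : lindblad 0 g (jump U) ρ = 0)
    (L : List (Fin n)) {Y : ChainOp n} (hY : ρ * Y = 0) :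
    ρ * L.foldl (fun Y j => cpMap U j Y) Y = 0 := by
  induction L generalizing Y with
  | nil => exact hY
  | cons k L ih => exact ih (mul_cpMap_eq_zero hg hρ hL k hY)

lemma mul_sweep_proj_eq_zero {N : ℕ} {U : Fin n → Fin N → BondOp}
    {g : Fin n × Fin N → ℝ} (hg : ∀ l, 0 < g l) {ρ : ChainOp n} (hρ : ρ.PosSemidef)
    (hL : lindblad 0 g (jump U) ρ = 0) (hΨ : ∀ l, jump U l *ᵥ Ψ = 0) (k : Fin n) :
    ρ * sweep U k (proj Ψ) = 0 := by
  -- The first map is split off: `ρ * proj Ψ` need not vanish, and darkness of Ψ takes the place of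
  -- that condition there.
  have hne : (List.ofFn fun j : Fin n => k + 1 + j) ≠ [] := by
    rw [Ne, List.ofFn_eq_nil_iff]; exact NeZero.ne n
  obtain ⟨j, L, hL'⟩ := List.exists_cons_of_ne_nil hne
  rw [sweep, hL', List.foldl_cons]
  refine mul_foldl_cpMap_eq_zero hg hρ hL L ?_
  rw [cpMap, Finset.mul_sum]
  exact Finset.sum_eq_zero fun α _ => mul_conjTranspose_mul_proj_eq_zero hρ hg hL hΨ (j, α)

lemma eq_proj_of_stationary (hn : 3 ≤ n) (hu : IsUnit Ψ)
    (hker : ∀ φ : ChainVec n, (∀ k, onBond k bondP *ᵥ φ = 0) ↔ ∃ z : ℂ, φ = z • Ψ)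
    {N : ℕ} {U : Fin n → Fin N → BondOp} (hU : ∀ k, IsTwirl (U k)) {g : Fin n × Fin N → ℝ}
    (hg : ∀ l, 0 < g l) {ρ : ChainOp n} (hρ : IsDensity ρ) (hL : lindblad 0 g (jump U) ρ = 0) :
    ρ = proj Ψ := by
  have hΨ : ∀ l, jump U l *ᵥ Ψ = 0 :=
    (jump_mulVec_eq_zero_iff hn hU Ψ).2 ((hker Ψ).2 ⟨1, (one_smul _ _).symm⟩)
  have hP : ∀ k, onBond k bondP * ρ = 0 := by
    intro k
    obtain ⟨C, hC, hs⟩ := exists_sweep_eq hn hU k (trace_proj hu)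
    have h := mul_sweep_proj_eq_zero hg hρ.1 hL hΨ k
    rw [hs, mul_smul_comm, smul_eq_zero] at h
    have h := h.resolve_left (by exact_mod_cast hC.ne')
    have := congrArg Matrix.conjTranspose h
    rwa [Matrix.conjTranspose_mul, (onBond_bondP_isHermitian k).eq, hρ.1.isHermitian.eq,
      Matrix.conjTranspose_zero] at this
  refine eq_proj_of_forall_mulVec hρ hu fun v => (hker _).1 fun k => ?_
  rw [Matrix.mulVec_mulVec, hP, Matrix.zero_mulVec]

end Ring

end AKLT

end

theorem mainTheorem6 :
    -- the bond interaction and the projector onto its spin-2 eigenspace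
    (Module.finrank ℂ (Module.End.eigenspace (Matrix.toLin' AKLT.bondH) (4 / 3 : ℂ)) = 5 ∧
      Module.finrank ℂ (Module.End.eigenspace (Matrix.toLin' AKLT.bondH) (-2 / 3 : ℂ)) = 4 ∧
      (∀ v, AKLT.bondH.mulVec v = (4 / 3 : ℂ) • v ↔
        AKLT.totalSpinSq.mulVec v = (6 : ℂ) • v) ∧
      AKLT.bondP.IsHermitian ∧ AKLT.bondP * AKLT.bondP = AKLT.bondP ∧
      ∀ v, AKLT.bondP.mulVec v = v ↔ AKLT.bondH.mulVec v = (4 / 3 : ℂ) • v) ∧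
    -- twirling families of unitaries exist
    (∃ (N : ℕ) (U : Fin N → AKLT.BondOp), AKLT.IsTwirl U) ∧
    ∀ (n : ℕ) [NeZero n], 3 ≤ n →
      ∃ Ψ : AKLT.ChainVec n,
        -- the ground state, its uniqueness, and frustration freeness
        AKLT.IsGroundState (AKLT.hamiltonian n) Ψ ∧
        (∀ φ, AKLT.IsGroundState (AKLT.hamiltonian n) φ → ∃ z : ℂ, ‖z‖ = 1 ∧ φ = z • Ψ) ∧
        (∀ φ : AKLT.ChainVec n,
          (∀ k, (AKLT.onBond k AKLT.bondH).mulVec φ = (-2 / 3 : ℂ) • φ) ↔ ∃ z : ℂ, φ = z • Ψ) ∧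
        -- the dissipative process with the jump operators `U_k^α P_k`
        (∀ (N : ℕ) (U : Fin n → Fin N → AKLT.BondOp), (∀ k, AKLT.IsTwirl (U k)) →
          (∀ l, AKLT.ActsOnBond l.1 (AKLT.jump U l)) ∧
          (∀ φ : AKLT.ChainVec n,
            (∀ l, (AKLT.jump U l).mulVec φ = 0) ↔ ∃ z : ℂ, φ = z • Ψ) ∧
          (∀ k, ∃ C : ℝ, 0 < C ∧
            AKLT.sweep U k (AKLT.proj Ψ) = (C : ℂ) • AKLT.onBond k AKLT.bondP) ∧
          ∀ g : Fin n × Fin N → ℝ, (∀ l, 0 < g l) →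
            ∀ ρ : AKLT.ChainOp n, AKLT.IsDensity ρ →
              (AKLT.lindblad 0 g (AKLT.jump U) ρ = 0 ↔ ρ = AKLT.proj Ψ)) ∧
        -- one jump operator per bond already excludes any other pure stationary state
        (∀ (Φ : Fin 5 → Fin 3 × Fin 3 → ℂ) (Ψ' : Fin 4 → Fin 3 × Fin 3 → ℂ),
          AKLT.IsEigenbasis Φ Ψ' →
          (∃ V ∈ Matrix.unitaryGroup (Fin 3 × Fin 3) ℂ, AKLT.ladder Φ Ψ' = V * AKLT.bondP) ∧
          (∀ v, (∃ μ : ℂ, (AKLT.ladder Φ Ψ').mulVec v = μ • v) ↔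
            AKLT.bondH.mulVec v = (-2 / 3 : ℂ) • v) ∧
          ∀ g : Fin n → ℝ, (∀ k, 0 < g k) →
            ∀ φ : AKLT.ChainVec n, AKLT.IsUnit φ →
              (AKLT.lindblad 0 g (fun k => AKLT.onBond k (AKLT.ladder Φ Ψ')) (AKLT.proj φ) = 0 ↔
                AKLT.proj φ = AKLT.proj Ψ)) := by
  refine ⟨⟨?_, ?_, AKLT.totalSpinSq_mulVec_iff, AKLT.bondP_isHermitian, AKLT.bondP_mul_self,
    AKLT.bondP_mulVec_eq_self_iff⟩, AKLT.exists_isTwirl, fun n _ hn => ?_⟩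
  · rw [AKLT.eigenspace_four_thirds, AKLT.finrank_range_bondP]
  · rw [AKLT.eigenspace_neg_two_thirds, AKLT.finrank_ker_bondP]
  obtain ⟨Ψ, hu, hker⟩ := AKLT.exists_unit_ker hn
  have hΨ : ∀ k, AKLT.onBond k AKLT.bondP *ᵥ Ψ = 0 := (hker Ψ).2 ⟨1, (one_smul _ _).symm⟩
  refine ⟨Ψ, AKLT.isGroundState_of_ker hn hu hΨ, fun φ hφ => ?_, fun φ => ?_, fun N U hU => ?_,
    fun Φ Ψ' h => ?_⟩
  · obtain ⟨z, rfl⟩ := (hker φ).1 (hφ.mem_ker hn hu hΨ)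
    exact ⟨z, AKLT.norm_eq_one_of_isUnit_smul hu hφ.1, rfl⟩
  · simp only [AKLT.onBond_bondH_mulVec_iff]
    exact hker φ
  · refine ⟨fun l => ⟨U l.1 l.2 * AKLT.bondP,
      (AKLT.onBond_mul (AKLT.add_one_ne_self hn _) _ _).symm⟩,
      fun φ => (AKLT.jump_mulVec_eq_zero_iff hn hU φ).trans (hker φ),
      fun k => AKLT.exists_sweep_eq hn hU k (AKLT.trace_proj hu),
      fun g hg ρ hρ => ⟨AKLT.eq_proj_of_stationary hn hu hker hU hg hρ, ?_⟩⟩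
    rintro rfl
    exact AKLT.lindblad_proj_eq_zero ((AKLT.jump_mulVec_eq_zero_iff hn hU Ψ).2 hΨ)
  · refine ⟨⟨_, h.ladderUnitary_mem, h.ladder_eq⟩, h.ladder_eigenvector_iff,
      fun g hg φ hφ => ⟨fun hL => ?_, fun e => ?_⟩⟩
    -- A pure stationary state is an eigenvector of each nilpotent jump operator, hence is killed by
    -- it and by the bond projector.
    · obtain ⟨z, rfl⟩ := (hker φ).1 fun k => by
        have hk := AKLT.add_one_ne_self hn k
        obtain ⟨μ, hμ⟩ := AKLT.mulVec_eq_smul_of_lindblad_proj hg hφ hL k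
        exact (h.onBond_ladder_mulVec_eq_zero_iff hk φ).1
          (AKLT.mulVec_eq_zero_of_nilpotent (h.onBond_ladder_nilpotent hk) hμ)
      exact AKLT.proj_smul (AKLT.norm_eq_one_of_isUnit_smul hu hφ) Ψ
    · rw [e]
      exact AKLT.lindblad_proj_eq_zero fun k =>
        (h.onBond_ladder_mulVec_eq_zero_iff (AKLT.add_one_ne_self hn k) Ψ).2 (hΨ k)
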